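/- Let $\Bbbk$ be a field. For $n\ge 0$ let $\vec A_n$ be the quiver $1\to 2\to\cdots\to n$, and let $CL(n)=\vec A_n\otimes\vec A_2$ be the equioriented commutative ladder: the quiver with vertices $(i,1)$ (lower row) and $(i,2)$ (upper row), $1\le i\le n$, arrows $(i,j)\to(i+1,j)$ and $(i,1)\to(i,2)$, and the relations that all squares commute. All representations are finite-dimensional over $\Bbbk$. For a finite quiver, $d_N(L)$ denotes the multiplicity of an indecomposable representation $L$ in a decomposition of $N$ into indecomposables. *Intervals.* An interval of $CL(n)$ is a (nonempty) connected full subquiver $I$ that is convex (it contains every vertex on a path between two of its vertices); intervals are ordered by containment of vertex sets, and $\mathbb I$ is the set of all of them. $V_I$ is the interval representation ($\Bbbk$ on $I$, $0$ elsewhere, identity maps inside $I$). Let $\mathbb I_1$ (resp. $\mathbb I_2$) be the set of intervals $[b,d]_1$ (resp. $[b,d]_2$) contained in the lower (resp. upper) row, and $\mathbb I_{2/1}$ the set of intervals $[b_2,d_2]_2\sqcup[b_1,d_1]_1$ that meet both rows. *Essential assignments.* A course $(C,F)$ is a finite connected quiver $C$ with a map $F$ from the vertices of $C$ to those of $CL(n)$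 such that for each arrow $a\to b$ of $C$ there is a path from $F(a)$ to $F(b)$ in $CL(n)$. It is essential in an interval $I$ if the image of $F$ lies in $I$ and contains all sources and all sinks of $I$. The tour of a representation $M$ of $CL(n)$ along $(C,F)$ is the representation of $C$ with the spaces $M_{F(a)}$ and the maps $M(F(a)\to F(b))$ along paths. An essential assignment $\xi$ chooses for each $I\in\mathbb I$ a course $\xi(I)$ essential in $I$. Put $c^\xi_M(I)=d_{\mathrm{tour}_{\xi(I)}(M)}(\mathrm{tour}_{\xi(I)}(V_I))$, and let $\delta^\xi_M\colon\mathbb I\to\mathbb Z$ be the unique function with $c^\xi_M(I)=\sum_{J\ge I}\delta^\xi_M(J)$ for all $I\in\mathbb I$. Define $\widetilde\delta^\xi_M\colon\mathbb I\to\mathbb Z$ by $$\widetilde\delta^\xi_M([b_1,d_1]_1)=\delta^\xi_M([b_1,d_1]_1)+\sum_{[b_2,d_2]_2\sqcup[b_1,d_1]_1\in\mathbb I_{2/1}}\delta^\xi_M([b_2,d_2]_2\sqcup[b_1,d_1]_1)$$ (sum over $b_2,d_2$), symmetrically $$\widetilde\delta^\xi_M([b_2,d_2]_2)=\delta^\xi_M([b_2,d_2]_2)+\sum_{[b_2,d_2]_2\sqcup[b_1,d_1]_1\in\mathbb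 I_{2/1}}\delta^\xi_M([b_2,d_2]_2\sqcup[b_1,d_1]_1)$$ (sum over $b_1,d_1$), and $\widetilde\delta^\xi_M=\delta^\xi_M$ on $\mathbb I_{2/1}$. *Diagrams.* The persistence diagram of a representation $N$ of $\vec A_n$ assigns to $(x,y)$ with $1\le x<y\le n+1$ the multiplicity $d_N(V_{[x,y-1]})$, and $0$ to all other points of $\mathbb Z^2$. The connected persistence diagram of $M$ assigns $\widetilde\delta^\xi_M([b,d-1]_1)$ to the points $(d,b)$ of the lower triangle ($d>b\geq 1$), $\widetilde\delta^\xi_M([b,d-1]_2)$ to the points $(b,d)$ of the upper triangle ($1\le b<d$), and $\widetilde\delta^\xi_M([b_2,d_2-1]_2\sqcup[b_1,d_1-1]_1)$ to the segments from $(b_2,d_2)$ in the upper to $(d_1,b_1)$ in the lower triangle with slope in $[-1,0]$ (and $0$ where this is not an interval of $CL(n)$). **Proposition.** Let $\xi$ be an essential assignment on $CL(n)$ and $M$ a representation of $CL(n)$, and let $\underline M$ and $\overline M$ be the representations of $\vec A_n$ given by the lower and the upper row of $M$. Then for all $1\le b\le d\le n$ $$d_{\underline M}(V_{[b,d]})=\widetilde\delta^\xi_M([b,d]_1)\qquad\text{and}\qquad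 d_{\overline M}(V_{[b,d]})=\widetilde\delta^\xi_M([b,d]_2).$$ Hence the connected persistence diagram of $M$ takes at each point $(d,b)$ of the lower triangle the value of the persistence diagram of $\underline M$ at $(b,d)$, and at each point $(b,d)$ of the upper triangle the value of the persistence diagram of $\overline M$ at $(b,d)$. -/

import Mathlib

open CategoryTheory CategoryTheory.Limits

universe u w w'

noncomputable section

/-! ### Quivers, representations, multiplicities -/

/-- The quiver `Q` is nonempty and its underlying graph is connected. -/
def QuiverConnected (Q : Type*) [Quiver Q] : Prop :=
  Nonempty Q ∧
    ∀ a b : Q, Relation.ReflTransGen (fun x y : Q => Nonempty (x ⟶ y) ∨ Nonempty (y ⟶ x)) a b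

/-- The full subquiver on a set of vertices. -/
abbrev fullSubquiver {Q : Type*} [Quiver Q] (S : Set Q) : Quiver S where
  Hom a b := a.1 ⟶ b.1

/-- Finite-dimensional representations over `k` of a quiver, as functors from its path category. -/
abbrev QRep (k : Type u) [Field k] (Q : Type w) [Quiver.{w'} Q] :=
  Paths Q ⥤ FGModuleCat.{u} k

instance {k : Type u} [Field k] {Q : Type w} [Quiver.{w'} Q] : HasFiniteBiproducts (QRep k Q) :=
  Abelian.hasFiniteBiproducts

/-- `M` is a representation of the quiver `Q` with the relations `p - q`, for `p`, `q` parallel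
paths with `R p q`. -/
def SatisfiesRelations {k : Type u} [Field k] {Q : Type w} [Quiver.{w'} Q]
    (R : HomRel (Paths Q)) (M : QRep k Q) : Prop :=
  ∀ ⦃a b : Paths Q⦄ (p q : a ⟶ b), R p q → M.map p = M.map q

/-- `M` is isomorphic to a finite direct sum of indecomposable representations, exactly `m` of
which are isomorphic to `L`. -/
def HasMultiplicity {k : Type u} [Field k] {Q : Type w} [Quiver.{w'} Q]
    (M L : QRep k Q) (m : ℕ) : Prop :=
  ∃ (r : ℕ) (N : Fin r → QRep k Q), (∀ i, Indecomposable (N i)) ∧ Nonempty (M ≅ ⨁ N) ∧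
    m = Nat.card {i : Fin r // Nonempty (N i ≅ L)}

open Classical in
/-- The multiplicity `d_M(L)` of the indecomposable `L` in `M`. For a finite quiver a decomposition
exists and the value does not depend on it, by the Krull-Schmidt theorem. -/
def indecMultiplicity (k : Type u) [Field k] {Q : Type w} [Quiver.{w'} Q] (M L : QRep k Q) : ℕ :=
  if h : ∃ m, HasMultiplicity M L m then h.choose else 0

/-! ### Intervals and interval representations -/

/-- The full subquiver on `S` is an interval: connected and convex. (All relations considered here
are commutativity relations, so that there are no zero relations to be avoided.) -/
def IsInterval {Q : Type*} [Quiver Q] (S : Set Q) : Prop :=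
  @QuiverConnected S (fullSubquiver S) ∧
    ∀ u ∈ S, ∀ v ∈ S, ∀ x : Q,
      Nonempty (Quiver.Path u x) → Nonempty (Quiver.Path x v) → x ∈ S

/-- The set of intervals of `Q`, partially ordered by containment of the vertex sets. -/
abbrev QInterval (Q : Type*) [Quiver Q] := {S : Set Q // IsInterval S}

open Classical in
/-- The map between the spaces of an interval representation at two vertices: the identity of `k` if
both vertices lie in `S`, and `0` otherwise. -/
def intervalMap (k : Type u) [Field k] {Q : Type w} (S : Set Q) (a b : Q) :
    (PLift (a ∈ S) → k) →ₗ[k] (PLift (b ∈ S) → k) where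
  toFun f _ := if h : a ∈ S then f ⟨h⟩ else 0
  map_add' f g := by funext x; by_cases h : a ∈ S <;> simp [h]
  map_smul' c f := by funext x; by_cases h : a ∈ S <;> simp [h]

instance (p : Prop) : Finite (PLift p) := Finite.of_injective (fun _ => ()) fun ⟨_⟩ ⟨_⟩ _ => rfl

/-- The interval representation: `k` (as the space of functions to `k` from a type with one point)
on the vertices in `S` and `0` (functions from an empty type) elsewhere; the map along an arrow is
the identity if both ends lie in `S` and `0` otherwise. -/
def intervalRep (k : Type u) [Field k] {Q : Type w} [Quiver.{w'} Q] (S : Set Q) : QRep k Q :=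
  Paths.lift
    { obj := fun v => FGModuleCat.of k (PLift (v ∈ S) → k)
      map := fun {a b} _ => FGModuleCat.ofHom (intervalMap k S a b) }

/-- The essential vertices: the sources and the sinks of the full subquiver on `S`. -/
def essentialVertices {Q : Type*} [Quiver Q] (S : Set Q) : Set Q :=
  {v | v ∈ S ∧ ((∀ u ∈ S, IsEmpty (u ⟶ v)) ∨ (∀ u ∈ S, IsEmpty (v ⟶ u)))}

/-! ### Courses, tours, compressed multiplicities -/

/-- A course on `Q`: a finite connected quiver with a labeling of its vertices by vertices of `Q`
such that every arrow is mapped to a pair of vertices connected by a path. -/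
structure Course (Q : Type*) [Quiver Q] where
  C : Type w
  [quiver : Quiver.{w'} C]
  [finite_vertices : Finite C]
  [finite_arrows : ∀ a b : C, Finite (a ⟶ b)]
  connected : QuiverConnected C
  F : C → Q
  path : ∀ {a b : C}, (a ⟶ b) → Nonempty (Quiver.Path (F a) (F b))

attribute [instance] Course.quiver Course.finite_vertices Course.finite_arrows

/-- The course `c` is essential in the interval with vertex set `S`. -/
def Course.IsEssential {Q : Type*} [Quiver Q] (c : Course.{w, w'} Q) (S : Set Q) : Prop :=
  essentialVertices S ⊆ Set.range c.F ∧ Set.range c.F ⊆ S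

/-- An essential assignment: an essential course in every interval. -/
structure EssentialAssignment (Q : Type*) [Quiver Q] where
  course : QInterval Q → Course.{w, w'} Q
  essential : ∀ I : QInterval Q, (course I).IsEssential I.1

/-- The tour of `M` on a course: at an arrow `a ⟶ b` of the course it is the evaluation of `M` on a
path from `F a` to `F b` (on a fully commutative quiver, the choice of the path is irrelevant). -/
def Course.tour {k : Type u} [Field k] {Q : Type*} [Quiver Q] (c : Course.{w, w'} Q)
    (M : QRep k Q) : QRep k c.C :=
  Paths.lift
    { obj := fun a => M.obj (c.F a)
      map := fun f => M.map (c.path f).some }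

/-- The `ξ`-compressed multiplicity of `M` on the interval `I`. -/
def compressedMultiplicity {k : Type u} [Field k] {Q : Type*} [Quiver Q]
    (ξ : EssentialAssignment.{w, w'} Q) (M : QRep k Q) (I : QInterval Q) : ℕ :=
  indecMultiplicity k ((ξ.course I).tour M) ((ξ.course I).tour (intervalRep k I.1))

/-! ### The interval approximation -/

instance {Q : Type*} [Quiver Q] [Finite Q] : Fintype (QInterval Q) := Fintype.ofFinite _

open Classical in
/-- For `c` on a finite poset, the function `δ` with `c x = ∑ y ≥ x, δ y`, built downwards from the
maximal elements. -/
def upperInversion {P : Type*} [PartialOrder P] [Fintype P] (c : P → ℤ) (x : P) : ℤ :=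
  c x - ∑ y : {y : P // x < y}, upperInversion c y.1
termination_by wellFounded_gt.wrap x
decreasing_by exact y.2

open Classical in
theorem upperInversion_spec {P : Type*} [PartialOrder P] [Fintype P] (c : P → ℤ) (x : P) :
    c x = ∑ y : P with x ≤ y, upperInversion c y := by
  have h : (Finset.univ.filter fun y : P => x ≤ y) =
      insert x (Finset.univ.filter fun y : P => x < y) := by
    ext y
    simp [le_iff_eq_or_lt, eq_comm]
  rw [h, Finset.sum_insert (by simp), upperInversion]
  rw [← Finset.sum_subtype_eq_sum_filter]
  simp [Finset.subtype_univ]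

open Classical in
theorem upperInversion_unique {P : Type*} [PartialOrder P] [Fintype P] (c δ : P → ℤ)
    (hδ : ∀ x, c x = ∑ y : P with x ≤ y, δ y) : δ = upperInversion c := by
  funext x
  induction x using (wellFounded_gt (α := P)).induction with
  | _ x ih =>
    have h1 := hδ x
    have h2 := upperInversion_spec c x
    have h : (Finset.univ.filter fun y : P => x ≤ y) =
        insert x (Finset.univ.filter fun y : P => x < y) := by
      ext y
      simp [le_iff_eq_or_lt, eq_comm]
    rw [h, Finset.sum_insert (by simp)] at h1 h2
    have h3 : ∑ y : P with x < y, δ y = ∑ y : P with x < y, upperInversion c y :=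
      Finset.sum_congr rfl fun y hy => ih y (by simpa using hy)
    linarith

/-- The interval approximation of `M` via the `ξ`-compressed multiplicities. -/
def intervalApproximation {k : Type u} [Field k] {Q : Type*} [Quiver Q] [Finite Q]
    (ξ : EssentialAssignment.{w, w'} Q) (M : QRep k Q) : QInterval Q → ℤ :=
  upperInversion fun I => (compressedMultiplicity ξ M I : ℤ)

/-! ### Commutative ladders -/

/-- The equioriented quiver of type `A_n`, with the vertices numbered from `0` to `n - 1`. -/
structure EquiA (n : ℕ) where
  idx : Fin n

instance (n : ℕ) : Quiver (EquiA n) where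
  Hom i j := PLift (i.idx.val + 1 = j.idx.val)

/-- The vertices of the Cartesian product of two quivers. -/
@[ext]
structure ProdQuiver (U V : Type*) where
  fst : U
  snd : V

/-- The arrows of the Cartesian product of two quivers. -/
inductive ProdQuiver.Arrow {U V : Type*} [Quiver U] [Quiver V] :
    ProdQuiver U V → ProdQuiver U V → Type _
  | horiz {a b : U} (α : a ⟶ b) (a' : V) : ProdQuiver.Arrow ⟨a, a'⟩ ⟨b, a'⟩
  | vert (a : U) {a' b' : V} (α' : a' ⟶ b') : ProdQuiver.Arrow ⟨a, a'⟩ ⟨a, b'⟩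

instance {U V : Type*} [Quiver U] [Quiver V] : Quiver (ProdQuiver U V) where
  Hom := ProdQuiver.Arrow

/-- The path of length one along `(α, a')`. -/
def ProdQuiver.horizPath {U V : Type*} [Quiver U] [Quiver V] {a b : U} (α : a ⟶ b) (a' : V) :
    (Paths.of (ProdQuiver U V)).obj ⟨a, a'⟩ ⟶ (Paths.of (ProdQuiver U V)).obj ⟨b, a'⟩ :=
  (Paths.of (ProdQuiver U V)).map (ProdQuiver.Arrow.horiz α a')

/-- The path of length one along `(a, α')`. -/
def ProdQuiver.vertPath {U V : Type*} [Quiver U] [Quiver V] (a : U) {a' b' : V} (α' : a' ⟶ b') :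
    (Paths.of (ProdQuiver U V)).obj ⟨a, a'⟩ ⟶ (Paths.of (ProdQuiver U V)).obj ⟨a, b'⟩ :=
  (Paths.of (ProdQuiver U V)).map (ProdQuiver.Arrow.vert a α')

/-- The relations of the tensor product of two quivers: all squares commute. -/
inductive tensorRel (U V : Type*) [Quiver U] [Quiver V] : HomRel (Paths (ProdQuiver U V))
  | square {a b : U} (α : a ⟶ b) {a' b' : V} (α' : a' ⟶ b') :
    tensorRel U V
      (ProdQuiver.vertPath a α' ≫ ProdQuiver.horizPath α b')
      (ProdQuiver.horizPath α a' ≫ ProdQuiver.vertPath b α')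

/-- The quiver of the equioriented commutative ladder of length `n`. The vertex `⟨⟨i⟩, ⟨0⟩⟩` is the
`(i + 1)`-st vertex of the lower row, and `⟨⟨i⟩, ⟨1⟩⟩` is the one above it. -/
abbrev Ladder (n : ℕ) := ProdQuiver (EquiA n) (EquiA 2)

instance (n : ℕ) : Finite (EquiA n) :=
  Finite.of_injective EquiA.idx (by rintro ⟨a⟩ ⟨b⟩ h; simpa using h)

instance (U V : Type*) [Finite U] [Finite V] : Finite (ProdQuiver U V) :=
  Finite.of_injective (fun x : ProdQuiver U V => (x.fst, x.snd))
    (by rintro ⟨a, b⟩ ⟨c, d⟩ h; simpa using h)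

/-- The relations of the commutative ladder. -/
abbrev ladderRel (n : ℕ) : HomRel (Paths (Ladder n)) := tensorRel (EquiA n) (EquiA 2)


theorem EquiA.path_le {n : ℕ} {i j : EquiA n} (p : Quiver.Path i j) : i.idx ≤ j.idx := by
  induction p with
  | nil => exact le_rfl
  | cons _ e ih =>
    have := e.down
    rw [Fin.le_def] at ih ⊢
    omega

theorem EquiA.path_unique {n : ℕ} {i j : EquiA n} (p q : Quiver.Path i j) : p = q := by
  induction p with
  | nil =>
    cases q with
    | nil => rfl
    | cons q e =>
      have h1 := EquiA.path_le q
      have h2 := e.down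
      rw [Fin.le_def] at h1
      omega
  | @cons b c p e ih =>
    cases q with
    | nil =>
      have h1 := EquiA.path_le p
      have h2 := e.down
      rw [Fin.le_def] at h1
      omega
    | @cons b' _ q e' =>
      have hb : b = b' := by
        obtain ⟨b⟩ := b
        obtain ⟨b'⟩ := b'
        have h1 := e.down
        have h2 := e'.down
        congr 1
        ext
        dsimp at h1 h2
        omega
      subst hb
      obtain ⟨e⟩ := e
      obtain ⟨e'⟩ := e'
      rw [ih q]

/-- A path in the first factor, in the row `a'` of the product. -/
abbrev ProdQuiver.row {U V : Type*} [Quiver U] [Quiver V] (a' : V) : U ⥤q ProdQuiver U V where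
  obj a := ⟨a, a'⟩
  map α := ProdQuiver.Arrow.horiz α a'

/-- A path in the second factor, in the column `a` of the product. -/
abbrev ProdQuiver.column {U V : Type*} [Quiver U] [Quiver V] (a : U) : V ⥤q ProdQuiver U V where
  obj a' := ⟨a, a'⟩
  map α' := ProdQuiver.Arrow.vert a α'

/-- Evaluation of a representation along a path. -/
def evalPath {k : Type u} [Field k] {Q : Type*} [Quiver Q] (M : QRep k Q) {x y : Q}
    (p : Quiver.Path x y) :
    M.obj ((Paths.of Q).obj x) ⟶ M.obj ((Paths.of Q).obj y) :=
  M.map (X := (Paths.of Q).obj x) (Y := (Paths.of Q).obj y) p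

theorem evalPath_nil {k : Type u} [Field k] {Q : Type*} [Quiver Q] (M : QRep k Q) (x : Q) :
    evalPath M (Quiver.Path.nil : Quiver.Path x x) = 𝟙 _ :=
  M.map_id _

theorem evalPath_cons {k : Type u} [Field k] {Q : Type*} [Quiver Q] (M : QRep k Q) {x y z : Q}
    (p : Quiver.Path x y) (e : y ⟶ z) :
    evalPath M (p.cons e) = evalPath M p ≫ evalPath M e.toPath :=
  M.map_comp (X := (Paths.of Q).obj x) (Y := (Paths.of Q).obj y) (Z := (Paths.of Q).obj z) p e.toPath

theorem evalPath_square {k : Type u} [Field k] {U V : Type*} [Quiver U] [Quiver V]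
    {M : QRep k (ProdQuiver U V)} (hM : SatisfiesRelations (tensorRel U V) M)
    {a b : U} (α : a ⟶ b) {a' b' : V} (α' : a' ⟶ b') :
    evalPath M ((ProdQuiver.column a).map α').toPath ≫ evalPath M ((ProdQuiver.row b').map α).toPath =
    evalPath M ((ProdQuiver.row a').map α).toPath ≫ evalPath M ((ProdQuiver.column b).map α').toPath := by
  have h := hM _ _ (tensorRel.square α α')
  rw [M.map_comp, M.map_comp] at h
  exact h

theorem evalPath_swap {k : Type u} [Field k] {U V : Type*} [Quiver U] [Quiver V]
    {M : QRep k (ProdQuiver U V)} (hM : SatisfiesRelations (tensorRel U V) M)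
    {a b : U} (α : a ⟶ b) {a' b' : V} (r : Quiver.Path a' b') :
    evalPath M ((ProdQuiver.column a).mapPath r) ≫ evalPath M ((ProdQuiver.row b').map α).toPath =
    evalPath M ((ProdQuiver.row a').map α).toPath ≫ evalPath M ((ProdQuiver.column b).mapPath r) := by
  induction r with
  | nil =>
    have h1 := evalPath_nil M ((ProdQuiver.column a).obj a')
    have h2 := evalPath_nil M ((ProdQuiver.column b).obj a')
    rw [Prefunctor.mapPath_nil, Prefunctor.mapPath_nil, h1, h2]
    exact (Category.id_comp _).trans (Category.comp_id _).symm
  | cons r e ih =>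
    rw [Prefunctor.mapPath_cons, Prefunctor.mapPath_cons, evalPath_cons, evalPath_cons,
      Category.assoc]
    refine (congrArg _ (evalPath_square hM α e)).trans ?_
    refine (Category.assoc _ _ _).symm.trans ?_
    refine (congrArg (fun f => f ≫ _) ih).trans ?_
    exact Category.assoc _ _ _

theorem evalPath_normal {k : Type u} [Field k] {U V : Type*} [Quiver U] [Quiver V]
    {M : QRep k (ProdQuiver U V)} (hM : SatisfiesRelations (tensorRel U V) M)
    {x y : ProdQuiver U V} (p : Quiver.Path x y) :
    ∃ (p₁ : Quiver.Path x.fst y.fst) (p₂ : Quiver.Path x.snd y.snd),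
      evalPath M p = evalPath M ((ProdQuiver.row x.snd).mapPath p₁) ≫
        evalPath M ((ProdQuiver.column y.fst).mapPath p₂) := by
  induction p with
  | nil =>
    refine ⟨.nil, .nil, (evalPath_nil M x).trans ?_⟩
    refine Eq.trans ?_ (congrArg₂ (fun f g => f ≫ g) (evalPath_nil M x) (evalPath_nil M x)).symm
    exact (Category.comp_id _).symm
  | cons p e ih =>
    obtain ⟨p₁, p₂, h⟩ := ih
    rw [evalPath_cons, h]
    change ProdQuiver.Arrow _ _ at e
    cases e with
    | horiz α a' =>
      refine ⟨p₁.cons α, p₂, ?_⟩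
      rw [Prefunctor.mapPath_cons, evalPath_cons, Category.assoc]
      refine (congrArg _ (evalPath_swap hM α p₂)).trans ?_
      exact (Category.assoc _ _ _).symm
    | vert a α' =>
      refine ⟨p₁, p₂.cons α', ?_⟩
      rw [Prefunctor.mapPath_cons, evalPath_cons, Category.assoc]

/-- Parallel paths in a commutative ladder evaluate to the same map: it is fully commutative. In
particular the choice of paths in the definition of a tour is irrelevant. -/
theorem ladder_fullyCommutative {k : Type u} [Field k] {n : ℕ} {M : QRep k (Ladder n)}
    (hM : SatisfiesRelations (ladderRel n) M) {x y : Ladder n} (p q : Quiver.Path x y) :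
    evalPath M p = evalPath M q := by
  obtain ⟨p₁, p₂, hp⟩ := evalPath_normal hM p
  obtain ⟨q₁, q₂, hq⟩ := evalPath_normal hM q
  rw [hp, hq, EquiA.path_unique p₁ q₁, EquiA.path_unique p₂ q₂]

/-- The lower (`r = 0`) or upper (`r = 1`) row of a representation of the ladder. -/
def rowRep {k : Type u} [Field k] {n : ℕ} (M : QRep k (Ladder n)) (r : Fin 2) :
    QRep k (EquiA n) :=
  Paths.lift
    { obj := fun i => M.obj ((Paths.of (Ladder n)).obj ⟨i, EquiA.mk r⟩)
      map := fun α => M.map (ProdQuiver.horizPath α (EquiA.mk r)) }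

/-- The part of a set of vertices of the ladder that lies in row `r`. -/
def rowPart {n : ℕ} (S : Set (Ladder n)) (r : Fin 2) : Set (EquiA n) := {i | ⟨i, ⟨r⟩⟩ ∈ S}

/-- The interval is entirely supported in row `r`. -/
def SupportedInRow {n : ℕ} (I : QInterval (Ladder n)) (r : Fin 2) : Prop :=
  ∀ v ∈ I.1, v.snd = ⟨r⟩

/-- The interval meets both rows. -/
def BridgesRows {n : ℕ} (I : QInterval (Ladder n)) : Prop :=
  (rowPart I.1 0).Nonempty ∧ (rowPart I.1 1).Nonempty

open Classical in
/-- The auxiliary function: an interval in one row gets its own value of the interval approximation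
plus those of all intervals that bridge the rows and have this interval as their part in that
row. -/
def auxiliaryFunction {k : Type u} [Field k] {n : ℕ}
    (ξ : EssentialAssignment.{w, w'} (Ladder n)) (M : QRep k (Ladder n))
    (I : QInterval (Ladder n)) : ℤ :=
  if SupportedInRow I 0 then
    intervalApproximation ξ M I +
      ∑ J : QInterval (Ladder n) with BridgesRows J ∧ rowPart J.1 0 = rowPart I.1 0,
        intervalApproximation ξ M J
  else if SupportedInRow I 1 then
    intervalApproximation ξ M I +
      ∑ J : QInterval (Ladder n) with BridgesRows J ∧ rowPart J.1 1 = rowPart I.1 1,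
        intervalApproximation ξ M J
  else intervalApproximation ξ M I

/-! ### Persistence diagrams -/

/-- The vertices `b, …, d` of `A_n`, counted from `1`. -/
def idxSegment (n : ℕ) (b d : ℤ) : Set (EquiA n) :=
  {i | b ≤ (i.idx.val : ℤ) + 1 ∧ (i.idx.val : ℤ) + 1 ≤ d}

open Classical in
/-- The persistence diagram of a one-parameter persistence module, as a multiplicity function: the
point `(x, y)` has the multiplicity of the interval representation of `[x, y - 1]`. -/
def persistenceDiagram {k : Type u} [Field k] {n : ℕ} (N : QRep k (EquiA n)) (p : ℤ × ℤ) : ℕ :=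
  if 1 ≤ p.1 ∧ p.1 < p.2 ∧ p.2 ≤ n + 1 then
    indecMultiplicity k N (intervalRep k (idxSegment n p.1 (p.2 - 1)))
  else 0

/-- The lower triangular region: points `(d, b)` with `d > b`. -/
def LowerTriangle : Set (ℤ × ℤ) := {p | 0 < p.1 ∧ 0 < p.2 ∧ p.2 < p.1}

/-- The upper triangular region: points `(b, d)` with `b < d`. -/
def UpperTriangle : Set (ℤ × ℤ) := {p | 0 < p.1 ∧ 0 < p.2 ∧ p.1 < p.2}

/-- The line segments from a point `(b₂, d₂)` of the upper to a point `(d₁, b₁)` of the lower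
triangle, with slope in `[-1, 0]`. -/
def ConnectingSegments : Set ((ℤ × ℤ) × (ℤ × ℤ)) :=
  {s | s.1 ∈ UpperTriangle ∧ s.2 ∈ LowerTriangle ∧
    -1 ≤ ((s.1.2 - s.2.2 : ℤ) : ℚ) / ((s.1.1 - s.2.1 : ℤ) : ℚ) ∧
    ((s.1.2 - s.2.2 : ℤ) : ℚ) / ((s.1.1 - s.2.1 : ℤ) : ℚ) ≤ 0}

open Classical in
/-- The value of the auxiliary function on a set of vertices, `0` if this is not an interval. -/
def auxiliaryValue {k : Type u} [Field k] {n : ℕ}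
    (ξ : EssentialAssignment.{w, w'} (Ladder n)) (M : QRep k (Ladder n))
    (S : Set (Ladder n)) : ℤ :=
  if h : IsInterval S then auxiliaryFunction ξ M ⟨S, h⟩ else 0

/-- The vertices `[b, d]_r` in row `r` of the ladder. -/
def rowSegment (n : ℕ) (r : Fin 2) (b d : ℤ) : Set (Ladder n) :=
  {v | v.snd = ⟨r⟩ ∧ v.fst ∈ idxSegment n b d}

/-- The connected persistence diagram of `M`, as a multiplicity function on points of the two
triangles and on line segments connecting them. Indices beyond `n` give multiplicity `0`. -/
def connectedPersistenceDiagram {k : Type u} [Field k] {n : ℕ}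
    (ξ : EssentialAssignment.{w, w'} (Ladder n)) (M : QRep k (Ladder n)) :
    LowerTriangle ⊕ UpperTriangle ⊕ ConnectingSegments → ℤ
  | .inl ⟨(d, b), _⟩ =>
    if d ≤ n + 1 then auxiliaryValue ξ M (rowSegment n 0 b (d - 1)) else 0
  | .inr (.inl ⟨(b, d), _⟩) =>
    if d ≤ n + 1 then auxiliaryValue ξ M (rowSegment n 1 b (d - 1)) else 0
  | .inr (.inr ⟨((b₂, d₂), (d₁, b₁)), _⟩) =>
    if d₁ ≤ n + 1 ∧ d₂ ≤ n + 1 then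
      auxiliaryValue ξ M (rowSegment n 1 b₂ (d₂ - 1) ∪ rowSegment n 0 b₁ (d₁ - 1))
    else 0

end

/-! Both sides of the claim are alternating sums of the same four ranks. Fix a row `r` of `M`, and
let rk(s,t) be the rank of its map from s to t, read as 0 when s or t falls off the row.

The interval [s,t] in row `r` has one source and one sink, and an essential course visits both. Its
compressed multiplicity is therefore rk(s,t), whatever the assignment
(`compressedMultiplicity_eq_finrank`). By the defining formula of δ, rk(s,t) is the sum of δ(J) over
all intervals J whose part in row `r` contains s and t (`sum_intervalApproximation_eq_finrank`).
Inclusion-exclusion over the neighbours s-1 and t+1 then gives rk(s,t) - rk(s-1,t) - rk(s,t+1) +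
rk(s-1,t+1) as the sum of δ(J) over the J whose part in row `r` is exactly [s,t]. Such a J is either
[s,t] itself or bridges the rows, so this sum is the auxiliary function
(`auxiliaryFunction_eq_sum`). The alternating sum of ranks is also the classical formula for the
multiplicity of the interval representation of [s,t] in a representation of A_n
(`indecMultiplicity_between`).

Multiplicities are computed without the Krull-Schmidt theorem. Interval representations, and their
tours, are bricks: every endomorphism is a scalar. For a brick L, the number of summands isomorphic
to L in any decomposition of N is the rank of the composition pairing of Hom(L,N) and Hom(N,L) into
End(L) = k (`finrank_range_compPairing`), which does not refer to the decomposition. For interval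
representations this pairing is read off at a single vertex (`indecMultiplicity_intervalRep`). -/

noncomputable section

/-! ### Multiplicities of bricks -/

section Brick

variable {k : Type*} [Field k] {𝒞 : Type*} [Category 𝒞] [Preadditive 𝒞] [Linear k 𝒞]

/-- The composition pairing of `Hom(L, N)` and `Hom(N, L)`, with values in `k` by means of a
functional on the endomorphisms of `L`. -/
def compPairing {L : 𝒞} (σ : (L ⟶ L) →ₗ[k] k) (N : 𝒞) : (L ⟶ N) →ₗ[k] (N ⟶ L) →ₗ[k] k :=
  (Linear.comp L N L).compr₂ σ

/-- The split monomorphism `x` makes `L` a direct summand of `N` with complement its cokernel. As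
`N` is indecomposable and `L` is nonzero, the cokernel vanishes. -/
theorem nonempty_iso_of_comp_eq_id [HasBinaryBiproducts 𝒞] [HasCokernels 𝒞] {L N : 𝒞}
    (hN : Indecomposable N) (hL : ¬ IsZero L) (x : L ⟶ N) (φ : N ⟶ L) (h : x ≫ φ = 𝟙 L) :
    Nonempty (N ≅ L) := by
  have : IsSplitMono x := ⟨⟨⟨φ, h⟩⟩⟩
  let b := binaryBiconeOfIsSplitMonoOfCokernel (f := x) (cokernelIsCokernel x)
  have hb : b.IsBilimit := isBilimitBinaryBiconeOfIsSplitMonoOfCokernel (cokernelIsCokernel x)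
  let e : N ≅ L ⊞ cokernel x := biprod.uniqueUpToIso L (cokernel x) hb
  rcases hN.2 _ _ e with h0 | h0
  · exact absurd h0 hL
  · have : Epi x := Preadditive.epi_of_cokernel_zero (h0.eq_of_tgt _ _)
    have : IsIso x := isIso_of_epi_of_isSplitMono x
    exact ⟨(asIso x).symm⟩

theorem nonempty_iso_of_pairing_ne_zero [HasBinaryBiproducts 𝒞] [HasCokernels 𝒞] {L N : 𝒞}
    (σ : (L ⟶ L) →ₗ[k] k) (hσ : ∀ f, f = σ f • 𝟙 L)
    (hN : Indecomposable N) (hL : ¬ IsZero L) {x : L ⟶ N} {φ : N ⟶ L} (h : σ (x ≫ φ) ≠ 0) :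
    Nonempty (N ≅ L) := by
  refine nonempty_iso_of_comp_eq_id hN hL x ((σ (x ≫ φ))⁻¹ • φ) ?_
  rw [Linear.comp_smul]
  nth_rw 2 [hσ (x ≫ φ)]
  rw [smul_smul, inv_mul_cancel₀ h, one_smul]

/-- The pairing on `M` is the sum of the pairings through the summands `N i`. A summand not
isomorphic to `L` contributes zero; one isomorphic to `L` contributes a form of rank one, and these
forms are independent. -/
theorem finrank_range_compPairing [HasFiniteBiproducts 𝒞] [HasBinaryBiproducts 𝒞] [HasCokernels 𝒞] {L M : 𝒞}
    (σ : (L ⟶ L) →ₗ[k] k) (hσ : ∀ f, f = σ f • 𝟙 L) (h1 : σ (𝟙 L) = 1)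
    {r : ℕ} (N : Fin r → 𝒞) (hN : ∀ i, Indecomposable (N i)) (e : M ≅ ⨁ N) :
    Module.finrank k (LinearMap.range (compPairing σ M)) =
      Nat.card {i : Fin r // Nonempty (N i ≅ L)} := by
  classical
  have hL : ¬ IsZero L := by
    intro h
    rw [h.eq_of_src (𝟙 L) 0, map_zero] at h1
    exact zero_ne_one h1
  have hmul : ∀ f g : L ⟶ L, σ (f ≫ g) = σ f * σ g := by
    intro f g
    conv_lhs => rw [hσ f, hσ g, Linear.smul_comp, Linear.comp_smul, Category.comp_id, map_smul,
      map_smul, h1]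
    simp
  let J := {i : Fin r // Nonempty (N i ≅ L)}
  let ε : ∀ j : J, N j ≅ L := fun j => j.2.some
  let p : ∀ j : J, M ⟶ L := fun j => e.hom ≫ biproduct.π N j.1 ≫ (ε j).hom
  let q : ∀ j : J, L ⟶ M := fun j => (ε j).inv ≫ biproduct.ι N j.1 ≫ e.inv
  have hqp : ∀ i j : J, σ (q i ≫ p j) = if i = j then 1 else 0 := by
    intro i j
    by_cases hij : i = j
    · subst hij
      simp [p, q, h1]
    · have : (i.1 : Fin r) ≠ j.1 := fun h => hij (Subtype.ext h)
      simp [p, q, hij, biproduct.ι_π_ne_assoc N this]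
  have hβ : ∀ (x : L ⟶ M) (φ : M ⟶ L),
      σ (x ≫ φ) = ∑ j : J, σ (x ≫ p j) * σ (q j ≫ φ) := by
    intro x φ
    have h2 : x ≫ φ = ∑ i : Fin r,
        (x ≫ e.hom ≫ biproduct.π N i) ≫ (biproduct.ι N i ≫ e.inv ≫ φ) := by
      have : x ≫ φ = (x ≫ e.hom) ≫ 𝟙 (⨁ N) ≫ e.inv ≫ φ := by simp
      rw [this, ← biproduct.total]
      simp only [Preadditive.sum_comp, Preadditive.comp_sum, Category.assoc]
    rw [h2, map_sum]
    -- A nonzero contribution would split `L` off the indecomposable `N i`.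
    have h3 : ∀ i : Fin r, i ∉ Finset.univ.filter (fun i => Nonempty (N i ≅ L)) →
        σ ((x ≫ e.hom ≫ biproduct.π N i) ≫ (biproduct.ι N i ≫ e.inv ≫ φ)) = 0 := by
      intro i hi
      by_contra hne
      exact hi (by simpa using nonempty_iso_of_pairing_ne_zero σ hσ (hN i) hL hne)
    rw [← Finset.sum_subset (Finset.subset_univ _) fun i _ hi => h3 i hi,
      ← Finset.sum_subtype_eq_sum_filter, Finset.subtype_univ]
    refine Finset.sum_congr rfl fun j _ => ?_
    rw [← hmul]
    have hpq : p j ≫ q j = e.hom ≫ biproduct.π N j.1 ≫ biproduct.ι N j.1 ≫ e.inv := by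
      simp [p, q]
    rw [Category.assoc x (p j), ← Category.assoc (p j), hpq]
    simp only [Category.assoc]
  -- The pairing factors through `J → k`; `a` is onto and `b` is injective because `q` and `p` are
  -- dual families by `hqp`, so the rank is the cardinality of `J`.
  let a : (L ⟶ M) →ₗ[k] (J → k) :=
    LinearMap.pi fun j => σ ∘ₗ Linear.rightComp k L (p j)
  let b : (J → k) →ₗ[k] (M ⟶ L) →ₗ[k] k :=
    ∑ j : J, LinearMap.smulRight (LinearMap.proj j) (σ ∘ₗ Linear.leftComp k L (q j))
  have hab : compPairing σ M = b ∘ₗ a := by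
    refine LinearMap.ext fun x => LinearMap.ext fun φ => ?_
    refine (hβ x φ).trans ?_
    simp only [a, b, LinearMap.comp_apply, LinearMap.sum_apply]
    rfl
  have ha : Function.Surjective a := by
    intro t
    refine ⟨∑ j, t j • q j, funext fun i => ?_⟩
    simp only [a, LinearMap.pi_apply, LinearMap.comp_apply, Linear.rightComp_apply,
      map_sum, map_smul, hqp, smul_eq_mul]
    rw [Finset.sum_eq_single i] <;> simp +contextual
  have hb : Function.Injective b := by
    rw [injective_iff_map_eq_zero]
    intro t ht
    funext i
    have := LinearMap.congr_fun ht (p i)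
    simp only [b, LinearMap.sum_apply, LinearMap.smulRight_apply, LinearMap.smul_apply,
      LinearMap.comp_apply, Linear.leftComp_apply, hqp, LinearMap.proj_apply] at this
    rw [Finset.sum_eq_single i] at this
    · simpa using this
    all_goals simp +contextual
  rw [hab, LinearMap.range_comp_of_range_eq_top _ (LinearMap.range_eq_top.2 ha),
    LinearMap.finrank_range_of_inj hb, Module.finrank_fintype_fun_eq_card, Nat.card_eq_fintype_card]

end Brick

/-! ### Existence of decompositions -/

section Decomposition

variable {𝒞 : Type*} [Category 𝒞] [Preadditive 𝒞] [HasFiniteBiproducts 𝒞]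

/-- A finite family whose members are exhibited as direct summands with direct sum `X`. -/
theorem nonempty_iso_biproduct {J : Type} [Fintype J] [DecidableEq J] {X : 𝒞} (N : J → 𝒞)
    (i : ∀ j, N j ⟶ X) (p : ∀ j, X ⟶ N j) (hi : ∀ j, i j ≫ p j = 𝟙 _)
    (hne : ∀ j j', j ≠ j' → i j ≫ p j' = 0) (hs : ∑ j, p j ≫ i j = 𝟙 X) :
    Nonempty (X ≅ ⨁ N) := by
  refine ⟨⟨biproduct.lift p, biproduct.desc i, ?_, ?_⟩⟩
  · rw [biproduct.lift_desc, hs]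
  · refine biproduct.hom_ext' _ _ fun j => biproduct.hom_ext _ _ fun j' => ?_
    simp only [biproduct.ι_desc_assoc, Category.assoc, biproduct.lift_π, Category.comp_id,
      biproduct.ι_π]
    split_ifs with h
    · subst h
      simp [hi]
    · exact hne j j' h

/-- Strong induction on an additive size that detects zero: if an object splits into two nonzero
summands, both are strictly smaller. The zero object is the empty sum. -/
theorem exists_iso_biproduct_indecomposable [HasBinaryBiproducts 𝒞] (size : 𝒞 → ℕ)
    (h0 : ∀ X, size X = 0 → IsZero X)
    (hadd : ∀ X Y Z : 𝒞, (X ≅ Y ⊞ Z) → size X = size Y + size Z) (X : 𝒞) :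
    ∃ (J : Type) (_ : Fintype J) (N : J → 𝒞),
      (∀ i, Indecomposable (N i)) ∧ Nonempty (X ≅ ⨁ N) := by
  classical
  induction hn : size X using Nat.strong_induction_on generalizing X with
  | _ n ih =>
    by_cases hX : IsZero X
    · refine ⟨Empty, inferInstance, Empty.elim, fun i => i.elim, ?_⟩
      exact nonempty_iso_biproduct _ (fun j => j.elim) (fun j => j.elim) (fun j => j.elim)
        (fun j => j.elim) (hX.eq_of_src _ _)
    by_cases hi : Indecomposable X
    · refine ⟨Unit, inferInstance, fun _ => X, fun _ => hi, ?_⟩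
      exact nonempty_iso_biproduct _ (fun _ => 𝟙 X) (fun _ => 𝟙 X) (by simp)
        (fun j j' h => absurd rfl h) (by simp)
    have : ∃ Y Z : 𝒞, Nonempty (X ≅ Y ⊞ Z) ∧ ¬ IsZero Y ∧ ¬ IsZero Z := by
      by_contra hcon
      push Not at hcon
      exact hi ⟨hX, fun Y Z e => or_iff_not_imp_left.2 fun h => hcon Y Z ⟨e⟩ h⟩
    obtain ⟨Y, Z, ⟨e⟩, hY, hZ⟩ := this
    have hs := hadd X Y Z e
    have hY' : size Y ≠ 0 := fun h => hY (h0 _ h)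
    have hZ' : size Z ≠ 0 := fun h => hZ (h0 _ h)
    obtain ⟨J, _, N, hN, ⟨f⟩⟩ := ih (size Y) (by omega) Y rfl
    obtain ⟨J', _, N', hN', ⟨f'⟩⟩ := ih (size Z) (by omega) Z rfl
    refine ⟨J ⊕ J', inferInstance, Sum.elim N N', ?_, ?_⟩
    · rintro (j | j)
      exacts [hN j, hN' j]
    · refine nonempty_iso_biproduct (Sum.elim N N')
        (fun j => match j with
          | .inl j => biproduct.ι N j ≫ f.inv ≫ biprod.inl ≫ e.inv
          | .inr j => biproduct.ι N' j ≫ f'.inv ≫ biprod.inr ≫ e.inv)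
        (fun j => match j with
          | .inl j => e.hom ≫ biprod.fst ≫ f.hom ≫ biproduct.π N j
          | .inr j => e.hom ≫ biprod.snd ≫ f'.hom ≫ biproduct.π N' j) ?_ ?_ ?_
      · rintro (j | j) <;> simp
      · rintro (j | j) (j' | j') h
        · have h' : j ≠ j' := fun hh => h (by rw [hh])
          simp
          exact biproduct.ι_π_ne N h'
        · simp
          rfl
        · simp
          rfl
        · have h' : j ≠ j' := fun hh => h (by rw [hh])
          simp
          exact biproduct.ι_π_ne N' h'
      · have t1 : ∑ j, (f.hom ≫ biproduct.π N j) ≫ (biproduct.ι N j ≫ f.inv) = 𝟙 Y := by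
          have : 𝟙 Y = f.hom ≫ 𝟙 _ ≫ f.inv := by simp
          rw [this, ← biproduct.total]
          simp only [Preadditive.sum_comp, Preadditive.comp_sum, Category.assoc]
        have t2 : ∑ j, (f'.hom ≫ biproduct.π N' j) ≫ (biproduct.ι N' j ≫ f'.inv) = 𝟙 Z := by
          have : 𝟙 Z = f'.hom ≫ 𝟙 _ ≫ f'.inv := by simp
          rw [this, ← biproduct.total]
          simp only [Preadditive.sum_comp, Preadditive.comp_sum, Category.assoc]
        have t3 : 𝟙 X = e.hom ≫ (biprod.fst ≫ 𝟙 Y ≫ biprod.inl + biprod.snd ≫ 𝟙 Z ≫ biprod.inr) ≫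
            e.inv := by
          simp [biprod.total]
        rw [Fintype.sum_sum_type]
        change ∑ j, (e.hom ≫ biprod.fst ≫ f.hom ≫ biproduct.π N j) ≫
            (biproduct.ι N j ≫ f.inv ≫ biprod.inl ≫ e.inv) +
          ∑ j, (e.hom ≫ biprod.snd ≫ f'.hom ≫ biproduct.π N' j) ≫
            (biproduct.ι N' j ≫ f'.inv ≫ biprod.inr ≫ e.inv) = 𝟙 X
        rw [t3, ← t1, ← t2]
        simp only [Preadditive.sum_comp, Preadditive.comp_sum, Preadditive.comp_add,
          Preadditive.add_comp, Category.assoc]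

end Decomposition

/-! ### Multiplicities of bricks among quiver representations -/

section

variable {k : Type u} [Field k] {Q : Type w} [Quiver.{w'} Q]

/-- The total dimension of a representation. -/
def totalDim [Finite Q] (M : QRep k Q) : ℕ :=
  letI := Fintype.ofFinite Q
  ∑ v : Q, Module.finrank k (M.obj ((Paths.of Q).obj v))

theorem isZero_of_totalDim_eq_zero [Finite Q] {M : QRep k Q} (h : totalDim M = 0) : IsZero M := by
  let := Fintype.ofFinite Q
  rw [IsZero.iff_id_eq_zero]
  refine NatTrans.ext (funext fun v => FGModuleCat.hom_ext (LinearMap.ext fun x => ?_))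
  have h1 := Finset.sum_eq_zero_iff.1 h v (Finset.mem_univ _)
  have := Module.finrank_zero_iff.1 h1
  exact Subsingleton.elim (α := M.obj ((Paths.of Q).obj v)) _ _

theorem totalDim_eq_add [Finite Q] {X Y Z : QRep k Q} (e : X ≅ Y ⊞ Z) :
    totalDim X = totalDim Y + totalDim Z := by
  unfold totalDim
  let := Fintype.ofFinite Q
  rw [← Finset.sum_add_distrib]
  refine Finset.sum_congr rfl fun v _ => ?_
  rw [← Module.finrank_prod]
  let i₁ := biprod.inl (X := Y) (Y := Z) ≫ e.inv
  let i₂ := biprod.inr (X := Y) (Y := Z) ≫ e.inv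
  let p₁ := e.hom ≫ biprod.fst (X := Y) (Y := Z)
  let p₂ := e.hom ≫ biprod.snd (X := Y) (Y := Z)
  have a11 : i₁ ≫ p₁ = 𝟙 _ := by simp [i₁, p₁]
  have a22 : i₂ ≫ p₂ = 𝟙 _ := by simp [i₂, p₂]
  have a12 : i₁ ≫ p₂ = 0 := by simp [i₁, p₂]
  have a21 : i₂ ≫ p₁ = 0 := by simp [i₂, p₁]
  have aa : p₁ ≫ i₁ + p₂ ≫ i₂ = 𝟙 _ := by
    have t3 : 𝟙 X = e.hom ≫ (biprod.fst ≫ biprod.inl + biprod.snd ≫ biprod.inr) ≫ e.inv := by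
      simp [biprod.total]
    rw [t3]
    simp only [i₁, i₂, p₁, p₂, Category.assoc, Preadditive.add_comp, Preadditive.comp_add]
  have app : ∀ {A B : QRep k Q} {f g : A ⟶ B}, f = g → ∀ x, (f.app v).hom.hom x =
    (g.app v).hom.hom x := fun h x => by rw [h]
  refine LinearEquiv.finrank_eq (LinearEquiv.ofLinearMap
    ((p₁.app v).hom.hom.prod (p₂.app v).hom.hom)
    ((i₁.app v).hom.hom.coprod (i₂.app v).hom.hom) ?_ ?_)
  · refine LinearMap.ext fun x => Prod.ext ?_ ?_
    · have h1 := app a11 x.1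
      have h2 := app a21 x.2
      refine (map_add (p₁.app v).hom.hom _ _).trans ?_
      exact (congrArg₂ (· + ·) h1 h2).trans (add_zero _)
    · have h1 := app a12 x.1
      have h2 := app a22 x.2
      refine (map_add (p₂.app v).hom.hom _ _).trans ?_
      exact (congrArg₂ (· + ·) h1 h2).trans (zero_add _)
  · exact LinearMap.ext fun x => app aa x

theorem exists_hasMultiplicity [Finite Q] (M L : QRep k Q) : ∃ m, HasMultiplicity M L m := by
  obtain ⟨J, _, N, hN, ⟨e⟩⟩ := exists_iso_biproduct_indecomposable (𝒞 := QRep k Q) totalDim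
    (fun _ => isZero_of_totalDim_eq_zero)
    (fun X Y Z e => totalDim_eq_add e) M
  let f := Fintype.equivFin J
  exact ⟨_, Fintype.card J, fun i => N (f.symm i), fun i => hN _,
    ⟨e ≪≫ (biproduct.reindex f.symm N).symm⟩, rfl⟩

/-- Whichever decomposition the definition picks, it has the same number of summands isomorphic to
`L`, since the rank of the pairing does not depend on it. -/
theorem indecMultiplicity_eq_finrank [Finite Q] (M : QRep k Q) {L : QRep k Q}
    (σ : (L ⟶ L) →ₗ[k] k) (hσ : ∀ f, f = σ f • 𝟙 L) (h1 : σ (𝟙 L) = 1) :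
    indecMultiplicity k M L = Module.finrank k (LinearMap.range (compPairing σ M)) := by
  have h := exists_hasMultiplicity M L
  rw [indecMultiplicity, dif_pos h]
  obtain ⟨r, N, hN, ⟨e⟩, hm⟩ := h.choose_spec
  rw [hm]
  exact (finrank_range_compPairing σ hσ h1 N hN e).symm

theorem indecMultiplicity_congr {M L L' : QRep k Q} (e : L ≅ L') :
    indecMultiplicity k M L = indecMultiplicity k M L' := by
  have : HasMultiplicity M L = HasMultiplicity M L' := by
    funext m
    unfold HasMultiplicity
    have : ∀ X : QRep k Q, Nonempty (X ≅ L) = Nonempty (X ≅ L') := fun X =>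
      propext ⟨fun ⟨f⟩ => ⟨f ≪≫ e⟩, fun ⟨f⟩ => ⟨f ≪≫ e.symm⟩⟩
    simp only [this]
  unfold indecMultiplicity
  rw [this]

end

/-! ### Morphisms from and to interval representations -/

section

variable {k : Type u} [Field k] {Q : Type w} [Quiver.{w'} Q]

/-- The space of a representation at a vertex. -/
abbrev QRep.space (N : QRep k Q) (v : Q) : Type u := N.obj ((Paths.of Q).obj v)

/-- The linear map of a representation along a path. -/
def pathMap (N : QRep k Q) {a b : Q} (p : Quiver.Path a b) : N.space a →ₗ[k] N.space b :=
  (evalPath N p).hom.hom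

/-- The component of a morphism of representations at a vertex. -/
def compAt {M N : QRep k Q} (f : M ⟶ N) (v : Q) : M.space v →ₗ[k] N.space v :=
  (f.app ((Paths.of Q).obj v)).hom.hom

@[simp]
theorem pathMap_nil (N : QRep k Q) (a : Q) :
    pathMap N (Quiver.Path.nil : Quiver.Path a a) = LinearMap.id :=
  congrArg (fun f => f.hom.hom) (evalPath_nil N a)

theorem pathMap_comp (N : QRep k Q) {a b c : Q} (p : Quiver.Path a b) (q : Quiver.Path b c) :
    pathMap N (p.comp q) = pathMap N q ∘ₗ pathMap N p :=
  congrArg (fun f => f.hom.hom) (N.map_comp (X := (Paths.of Q).obj a) (Y := (Paths.of Q).obj b)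
    (Z := (Paths.of Q).obj c) p q)

theorem compAt_pathMap {M N : QRep k Q} (f : M ⟶ N) {a b : Q} (p : Quiver.Path a b)
    (x : M.space a) : compAt f b (pathMap M p x) = pathMap N p (compAt f a x) :=
  LinearMap.congr_fun (congrArg (fun f => f.hom.hom) (f.naturality (X := (Paths.of Q).obj a)
    (Y := (Paths.of Q).obj b) p)) x

/-- A morphism of representations from its components. -/
def homMk {M N : QRep k Q} (f : ∀ v, M.space v →ₗ[k] N.space v)
    (h : ∀ {a b : Q} (e : a ⟶ b), f b ∘ₗ pathMap M e.toPath = pathMap N e.toPath ∘ₗ f a) : M ⟶ N :=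
  Paths.liftNatTrans (fun v => FGModuleCat.ofHom (f v)) fun e => FGModuleCat.hom_ext (h e)

theorem hom_ext_compAt {M N : QRep k Q} {f g : M ⟶ N} (h : ∀ v, compAt f v = compAt g v) : f = g :=
  NatTrans.ext (funext fun v => FGModuleCat.hom_ext (h v))

theorem pathMap_intervalRep (S : Set Q) {a b : Q} (e : a ⟶ b) :
    pathMap (intervalRep k S) e.toPath = intervalMap k S a b :=
  congrArg (fun f : (intervalRep k S).obj ((Paths.of Q).obj a) ⟶
    (intervalRep k S).obj ((Paths.of Q).obj b) => f.hom.hom) (Paths.lift_toPath _ e)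

variable (k) in
/-- The generator of an interval representation at a vertex; it is zero outside of the interval. -/
def intervalUnit (S : Set Q) (v : Q) : (intervalRep k S).space v := fun _ => (1 : k)

open Classical in
variable (k) in
/-- The coordinate with respect to `intervalUnit`. -/
def intervalCoord (S : Set Q) (v : Q) : (intervalRep k S).space v →ₗ[k] k where
  toFun f := if h : v ∈ S then (show PLift (v ∈ S) → k from f) ⟨h⟩ else 0
  map_add' f g := by
    by_cases h : v ∈ S
    · simp only [h, dite_true]; rfl
    · simp [h]
  map_smul' c f := by
    by_cases h : v ∈ S
    · simp only [h, dite_true]; rfl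
    · simp [h]

variable {S : Set Q}

theorem intervalCoord_unit {v : Q} (hv : v ∈ S) : intervalCoord k S v (intervalUnit k S v) = 1 := by
  simp [intervalCoord, intervalUnit, hv]

theorem intervalCoord_of_notMem {v : Q} (hv : v ∉ S) : intervalCoord k S v = 0 :=
  LinearMap.ext fun f => by simp [intervalCoord, hv]

theorem intervalCoord_smul_unit {v : Q} (f : (intervalRep k S).space v) :
    intervalCoord k S v f • intervalUnit k S v = f := by
  funext x
  change intervalCoord k S v f * (1 : k) = f x
  have hv : v ∈ S := x.down
  simp only [intervalCoord, LinearMap.coe_mk, AddHom.coe_mk, hv, dite_true, mul_one]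
  rfl

/-- No case distinction on the endpoints is needed: the coordinate vanishes when `a` is outside `S`,
the unit when `b` is. -/
theorem pathMap_intervalRep_apply {a b : Q} (e : a ⟶ b) (f : (intervalRep k S).space a) :
    pathMap (intervalRep k S) e.toPath f = intervalCoord k S a f • intervalUnit k S b := by
  rw [pathMap_intervalRep]
  funext x
  change _ = intervalCoord k S a f * (1 : k)
  rw [mul_one]
  rfl

theorem pathMap_intervalUnit {a b : Q} (e : a ⟶ b) (ha : a ∈ S) :
    pathMap (intervalRep k S) e.toPath (intervalUnit k S a) = intervalUnit k S b := by
  rw [pathMap_intervalRep_apply, intervalCoord_unit ha, one_smul]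

variable {N : QRep k Q}

/-- The morphism from an interval representation that is given by a compatible family of vectors. -/
def sectionHom (x : ∀ v, N.space v) (h0 : ∀ v ∉ S, x v = 0)
    (h : ∀ {a b : Q} (e : a ⟶ b), a ∈ S → pathMap N e.toPath (x a) = x b) :
    intervalRep k S ⟶ N :=
  homMk (fun v => (intervalCoord k S v).smulRight (x v)) fun {a b} e => by
    refine LinearMap.ext fun f => ?_
    by_cases ha : a ∈ S
    · by_cases hb : b ∈ S
      · simp [pathMap_intervalRep_apply, intervalCoord_unit hb, h e ha]
      · simp [intervalCoord_of_notMem hb, h e ha, h0 b hb]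
    · simp [pathMap_intervalRep_apply, intervalCoord_of_notMem ha]

theorem compAt_sectionHom_unit (x : ∀ v, N.space v) (h0 : ∀ v ∉ S, x v = 0)
    (h : ∀ {a b : Q} (e : a ⟶ b), a ∈ S → pathMap N e.toPath (x a) = x b) {v : Q} (hv : v ∈ S) :
    compAt (sectionHom x h0 h) v (intervalUnit k S v) = x v := by
  change intervalCoord k S v (intervalUnit k S v) • x v = x v
  rw [intervalCoord_unit hv, one_smul]

/-- The morphism to an interval representation that is given by a compatible family of
functionals. -/
def cosectionHom (ψ : ∀ v, N.space v →ₗ[k] k) (h0 : ∀ v ∉ S, ψ v = 0)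
    (h : ∀ {a b : Q} (e : a ⟶ b), b ∈ S → ψ b ∘ₗ pathMap N e.toPath = ψ a) :
    N ⟶ intervalRep k S :=
  homMk (fun v => (ψ v).smulRight (intervalUnit k S v)) fun {a b} e => by
    refine LinearMap.ext fun y => ?_
    by_cases hb : b ∈ S
    · have h1 := LinearMap.congr_fun (h e hb) y
      by_cases ha : a ∈ S
      · simp only [LinearMap.comp_apply] at h1
        simp [pathMap_intervalRep_apply, intervalCoord_unit ha, h1]
      · simp only [LinearMap.comp_apply, h0 a ha] at h1
        simp [h1, h0 a ha]
    · simp only [LinearMap.comp_apply]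
      funext x
      exact absurd x.down hb

theorem intervalCoord_compAt_cosectionHom (ψ : ∀ v, N.space v →ₗ[k] k) (h0 : ∀ v ∉ S, ψ v = 0)
    (h : ∀ {a b : Q} (e : a ⟶ b), b ∈ S → ψ b ∘ₗ pathMap N e.toPath = ψ a) {v : Q} (hv : v ∈ S)
    (y : N.space v) :
    intervalCoord k S v (compAt (cosectionHom ψ h0 h) v y) = ψ v y := by
  change intervalCoord k S v (ψ v y • intervalUnit k S v) = ψ v y
  rw [map_smul, intervalCoord_unit hv, smul_eq_mul, mul_one]

theorem pathMap_compAt_unit (x : intervalRep k S ⟶ N) {a b : Q} (e : a ⟶ b) (ha : a ∈ S) :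
    pathMap N e.toPath (compAt x a (intervalUnit k S a)) = compAt x b (intervalUnit k S b) := by
  rw [← compAt_pathMap, pathMap_intervalUnit e ha]

theorem intervalCoord_compAt_pathMap (φ : N ⟶ intervalRep k S) {a b : Q} (e : a ⟶ b) (hb : b ∈ S)
    (y : N.space a) :
    intervalCoord k S b (compAt φ b (pathMap N e.toPath y)) =
      intervalCoord k S a (compAt φ a y) := by
  rw [compAt_pathMap, pathMap_intervalRep_apply, map_smul, intervalCoord_unit hb, smul_eq_mul,
    mul_one]

theorem compAt_unit_of_notMem (x : intervalRep k S ⟶ N) {v : Q} (hv : v ∉ S) :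
    compAt x v (intervalUnit k S v) = 0 := by
  have : intervalUnit k S v = 0 := funext fun y => absurd y.down hv
  rw [this, map_zero]

/-- Any two vertices of `S` are joined by a walk in the full subquiver on `S`. -/
def WalkConnectedOn (S : Set Q) : Prop :=
  ∀ a b : S, Relation.ReflTransGen
    (fun x y : S => Nonempty (x.1 ⟶ y.1) ∨ Nonempty (y.1 ⟶ x.1)) a b

theorem WalkConnectedOn.eq (hS : WalkConnectedOn S) {α : Sort*} (f : Q → α)
    (hf : ∀ {a b : Q}, (a ⟶ b) → a ∈ S → b ∈ S → f a = f b) {a b : Q} (ha : a ∈ S) (hb : b ∈ S) :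
    f a = f b := by
  have := hS ⟨a, ha⟩ ⟨b, hb⟩
  suffices h : ∀ x y : S, Relation.ReflTransGen
      (fun x y : S => Nonempty (x.1 ⟶ y.1) ∨ Nonempty (y.1 ⟶ x.1)) x y → f x.1 = f y.1 from
    h _ _ this
  intro x y hxy
  induction hxy with
  | refl => rfl
  | @tail y z _ h ih =>
    rcases h with ⟨⟨e⟩⟩ | ⟨⟨e⟩⟩
    · exact ih.trans (hf e y.2 z.2)
    · exact ih.trans (hf e z.2 y.2).symm

variable (k) in
/-- The scalar by which an endomorphism of an interval representation acts at a vertex. -/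
def endScalar (S : Set Q) (t : Q) : (intervalRep k S ⟶ intervalRep k S) →ₗ[k] k where
  toFun f := intervalCoord k S t (compAt f t (intervalUnit k S t))
  map_add' f _ := map_add (intervalCoord k S t) (compAt f t (intervalUnit k S t)) _
  map_smul' c f := map_smul (intervalCoord k S t) c (compAt f t (intervalUnit k S t))

/-- Interval representations are bricks: by naturality the scalars at the two ends of an arrow
inside `S` agree, and `S` is connected. -/
theorem eq_endScalar_smul_id (hS : WalkConnectedOn S) {t : Q} (ht : t ∈ S)
    (f : intervalRep k S ⟶ intervalRep k S) : f = endScalar k S t f • 𝟙 (intervalRep k S) := by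
  refine hom_ext_compAt fun v => LinearMap.ext fun y => ?_
  change compAt f v y = endScalar k S t f • y
  rw [← intervalCoord_smul_unit y, map_smul, smul_comm]
  congr 1
  by_cases hv : v ∈ S
  · rw [hS.eq (fun v => endScalar k S v f) (fun {a b} e ha hb => ?_) ht hv]
    · exact (intervalCoord_smul_unit _).symm
    · change intervalCoord k S a (compAt f a (intervalUnit k S a)) =
        intervalCoord k S b (compAt f b (intervalUnit k S b))
      rw [← intervalCoord_compAt_pathMap f e hb, pathMap_intervalUnit e ha]
  · funext z
    exact absurd z.down hv

/-- Rank-nullity for `q` restricted to `X`. -/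
theorem finrank_map_add_finrank_inf_ker {V W : Type*} [AddCommGroup V] [Module k V]
    [AddCommGroup W] [Module k W] [FiniteDimensional k V] (q : V →ₗ[k] W) (X : Submodule k V) :
    Module.finrank k (X.map q) + Module.finrank k (X ⊓ LinearMap.ker q : Submodule k V) =
      Module.finrank k X := by
  rw [← LinearMap.finrank_range_add_finrank_ker (q.domRestrict X), LinearMap.range_domRestrict,
    LinearMap.ker_domRestrict, ← Submodule.map_comap_subtype, Submodule.finrank_map_subtype_eq]

/-- The pairing of `x` and `φ` is the scalar by which their composite acts at `t`, that is, the
coordinate of `φ` on `g` of the value of `x` at `s`. `K` collects the values at `s` of morphisms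
from the interval representation, and `B` the vectors at `t` killed by all morphisms to it. The rank
is thus the dimension of `g(K)` modulo `B`. -/
theorem indecMultiplicity_intervalRep [Finite Q] (hS : WalkConnectedOn S) {s t : Q} (ht : t ∈ S)
    (g : N.space s →ₗ[k] N.space t)
    (hg : ∀ x : intervalRep k S ⟶ N,
      g (compAt x s (intervalUnit k S s)) = compAt x t (intervalUnit k S t))
    (K : Submodule k (N.space s))
    (hK : ∀ y, y ∈ K ↔ ∃ x : intervalRep k S ⟶ N, compAt x s (intervalUnit k S s) = y)
    (B : Submodule k (N.space t))
    (hB : ∀ y, y ∈ B ↔ ∀ φ : N ⟶ intervalRep k S, intervalCoord k S t (compAt φ t y) = 0) :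
    indecMultiplicity k N (intervalRep k S) +
      Module.finrank k (K.map g ⊓ B : Submodule k (N.space t)) = Module.finrank k (K.map g) := by
  rw [indecMultiplicity_eq_finrank N (endScalar k S t) (eq_endScalar_smul_id hS ht)
    (intervalCoord_unit ht)]
  let q : N.space t →ₗ[k] (N ⟶ intervalRep k S) →ₗ[k] k :=
    LinearMap.mk₂ k (fun y φ => intervalCoord k S t (compAt φ t y))
      (fun y y' φ => by simp) (fun c y φ => by simp)
      (fun y φ φ' => map_add (intervalCoord k S t) (compAt φ t y) _)
      (fun c y φ => map_smul (intervalCoord k S t) c (compAt φ t y))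
  have hq : LinearMap.ker q = B := by
    ext y
    rw [hB, LinearMap.mem_ker, LinearMap.ext_iff]
    rfl
  have hr : LinearMap.range (compPairing (endScalar k S t) N) = (K.map g).map q := by
    have hβ : ∀ x : intervalRep k S ⟶ N, compPairing (endScalar k S t) N x =
        q (g (compAt x s (intervalUnit k S s))) := fun x => by
      rw [hg]
      rfl
    ext l
    simp only [LinearMap.mem_range, Submodule.mem_map, exists_exists_and_eq_and, hβ, hK]
    constructor
    · rintro ⟨x, rfl⟩
      exact ⟨_, ⟨x, rfl⟩, rfl⟩
    · rintro ⟨_, ⟨x, rfl⟩, rfl⟩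
      exact ⟨x, rfl⟩
  rw [hr, ← hq]
  exact finrank_map_add_finrank_inf_ker q _

end

/-! ### Compressed multiplicities on intervals with one source and one sink -/

section

variable {k : Type u} [Field k] {Q : Type*} [Quiver Q] {S : Set Q}

theorem pathMap_intervalRep_of_convex
    (hS : ∀ u ∈ S, ∀ v ∈ S, ∀ x : Q,
      Nonempty (Quiver.Path u x) → Nonempty (Quiver.Path x v) → x ∈ S)
    {a b : Q} (p : Quiver.Path a b) (ha : a ∈ S) (hb : b ∈ S) (f : (intervalRep k S).space a) :
    pathMap (intervalRep k S) p f = intervalCoord k S a f • intervalUnit k S b := by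
  induction p with
  | nil => rw [intervalCoord_smul_unit, pathMap_nil, LinearMap.id_apply]
  | @cons m c p e ih =>
    have hm : m ∈ S := hS a ha c hb m ⟨p⟩ ⟨e.toPath⟩
    have h := LinearMap.congr_fun (pathMap_comp (intervalRep k S) p e.toPath) f
    refine h.trans ?_
    rw [LinearMap.comp_apply, ih hm, map_smul, pathMap_intervalUnit e hm]

theorem pathMap_tour (c : Course.{w, w'} Q) (M : QRep k Q) {a b : c.C} (e : a ⟶ b) :
    pathMap (c.tour M) e.toPath = pathMap M (c.path e).some :=
  congrArg (fun f : (c.tour M).obj ((Paths.of c.C).obj a) ⟶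
    (c.tour M).obj ((Paths.of c.C).obj b) => f.hom.hom) (Paths.lift_toPath _ e)

variable (k) in
/-- The tour of an interval representation along a course in the interval is constant. -/
def tourIntervalRepIso (hS : IsInterval S) (c : Course.{w, w'} Q) (hc : Set.range c.F ⊆ S) :
    c.tour (intervalRep k S) ≅ intervalRep k (Set.univ : Set c.C) where
  hom := homMk (fun a => (intervalCoord k S (c.F a)).smulRight (intervalUnit k Set.univ a))
    fun {a b} e => by
      refine LinearMap.ext fun f => ?_
      have h := pathMap_intervalRep_of_convex hS.2 (c.path e).some (hc ⟨a, rfl⟩) (hc ⟨b, rfl⟩) f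
      rw [pathMap_tour]
      change intervalCoord k S (c.F b) (pathMap _ _ f) • intervalUnit k Set.univ b =
        pathMap _ e.toPath (intervalCoord k S (c.F a) f • intervalUnit k Set.univ a)
      refine (congrArg (fun z => intervalCoord k S (c.F b) z • intervalUnit k Set.univ b) h).trans ?_
      rw [map_smul, map_smul, intervalCoord_unit (hc ⟨b, rfl⟩),
        pathMap_intervalUnit e (Set.mem_univ a), smul_eq_mul, mul_one]
  inv := homMk (fun a => (intervalCoord k Set.univ a).smulRight (intervalUnit k S (c.F a)))
    fun {a b} e => by
      refine LinearMap.ext fun f => ?_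
      have h := pathMap_intervalRep_of_convex hS.2 (c.path e).some (hc ⟨a, rfl⟩) (hc ⟨b, rfl⟩)
        (intervalCoord k Set.univ a f • intervalUnit k S (c.F a))
      rw [pathMap_tour]
      change intervalCoord k Set.univ b (pathMap _ e.toPath f) • intervalUnit k S (c.F b) =
        pathMap _ _ (intervalCoord k Set.univ a f • intervalUnit k S (c.F a))
      rw [h, pathMap_intervalRep_apply, map_smul, map_smul, intervalCoord_unit (Set.mem_univ b),
        intervalCoord_unit (hc ⟨a, rfl⟩)]
  hom_inv_id := hom_ext_compAt fun a => LinearMap.ext fun f => by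
    change intervalCoord k Set.univ a (intervalCoord k S (c.F a) f • intervalUnit k Set.univ a) •
      intervalUnit k S (c.F a) = f
    rw [map_smul, intervalCoord_unit (Set.mem_univ a), smul_eq_mul, mul_one]
    exact intervalCoord_smul_unit _
  inv_hom_id := hom_ext_compAt fun a => LinearMap.ext fun f => by
    change intervalCoord k S (c.F a) (intervalCoord k Set.univ a f • intervalUnit k S (c.F a)) •
      intervalUnit k Set.univ a = f
    rw [map_smul, intervalCoord_unit (hc ⟨a, rfl⟩), smul_eq_mul, mul_one]
    exact intervalCoord_smul_unit _

/-- The tour of the interval representation is the constant representation of the course. Since `s`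
reaches all of `I` and parallel paths act equally, every vector at `s` spreads to a morphism from
the constant representation; dually, every functional at `t` pulls back to a morphism to it. So
`indecMultiplicity_intervalRep` applies with `K = ⊤` and `B = ⊥`, which leaves the rank of the map
from `s` to `t`. -/
theorem compressedMultiplicity_eq_finrank (ξ : EssentialAssignment.{w, w'} Q) {M : QRep k Q}
    (hM : ∀ {a b : Q} (p q : Quiver.Path a b), pathMap M p = pathMap M q) (I : QInterval Q)
    {s t : Q} (hs : s ∈ essentialVertices I.1) (ht : t ∈ essentialVertices I.1)
    (hsv : ∀ v ∈ I.1, Nonempty (Quiver.Path s v)) (hvt : ∀ v ∈ I.1, Nonempty (Quiver.Path v t))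
    (p : Quiver.Path s t) :
    compressedMultiplicity ξ M I = Module.finrank k (LinearMap.range (pathMap M p)) := by
  unfold compressedMultiplicity
  obtain ⟨he, hc⟩ := ξ.essential I
  generalize ξ.course I = c at he hc
  rw [indecMultiplicity_congr (tourIntervalRepIso k I.2 c hc)]
  obtain ⟨a, rfl⟩ := he hs
  obtain ⟨b, rfl⟩ := he ht
  let σ : ∀ v : c.C, Quiver.Path (c.F a) (c.F v) := fun v => (hsv _ (hc ⟨v, rfl⟩)).some
  let τ : ∀ v : c.C, Quiver.Path (c.F v) (c.F b) := fun v => (hvt _ (hc ⟨v, rfl⟩)).some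
  have hcomp : ∀ {x y z : Q} (p : Quiver.Path x y) (q : Quiver.Path y z) (r : Quiver.Path x z)
      (u : M.space x), pathMap M q (pathMap M p u) = pathMap M r u := fun p q r u => by
    rw [hM r (p.comp q), pathMap_comp, LinearMap.comp_apply]
  have hconn : WalkConnectedOn (Set.univ : Set c.C) := by
    intro x y
    have := c.connected.2 x.1 y.1
    exact this.lift (fun v => (⟨v, Set.mem_univ v⟩ : (Set.univ : Set c.C))) fun _ _ h => h
  have key := indecMultiplicity_intervalRep (k := k) (N := c.tour M) hconn (s := a) (t := b)
    (Set.mem_univ b) (pathMap M p) ?_ ⊤ ?_ ⊥ ?_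
  · rw [inf_bot_eq, finrank_bot, add_zero] at key
    exact key.trans (congrArg (fun X : Submodule k (M.space (c.F b)) => Module.finrank k X)
      (Submodule.map_top _))
  · intro x
    -- The course need not contain a directed path from `a` to `b`. Instead all components are
    -- transported to the sink, where they agree along each arrow of the course and hence, by
    -- connectedness, everywhere.
    let f : c.C → M.space (c.F b) := fun v => pathMap M (τ v) (compAt x v (intervalUnit k _ v))
    have h1 : f a = f b := hconn.eq f (fun {v v'} e _ _ => by
      have h2 : pathMap M (c.path e).some (compAt x v (intervalUnit k _ v)) =
          compAt x v' (intervalUnit k _ v') := by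
        rw [← pathMap_compAt_unit x e (Set.mem_univ v), pathMap_tour]
        rfl
      exact (hcomp (c.path e).some (τ v') (τ v) _).symm.trans
        (congrArg (pathMap M (τ v')) h2)) (Set.mem_univ a) (Set.mem_univ b)
    refine (LinearMap.congr_fun (hM p (τ a)) _).trans (h1.trans ?_)
    exact (LinearMap.congr_fun (hM (τ b) Quiver.Path.nil) _).trans
      (LinearMap.congr_fun (pathMap_nil M _) _)
  · intro y
    refine ⟨fun _ => ⟨sectionHom (fun v => pathMap M (σ v) y) (fun v hv => absurd (Set.mem_univ v) hv)
      (fun {v v'} e _ => ?_), ?_⟩, fun _ => Submodule.mem_top⟩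
    · rw [pathMap_tour]
      exact hcomp (σ v) (c.path e).some (σ v') y
    · refine (compAt_sectionHom_unit _ _ _ (Set.mem_univ a)).trans ?_
      exact (LinearMap.congr_fun (hM (σ a) Quiver.Path.nil) _).trans
        (LinearMap.congr_fun (pathMap_nil M _) _)
  · intro y
    refine ⟨fun hy φ => by rw [(Submodule.mem_bot k).1 hy, map_zero, map_zero], fun h => ?_⟩
    rw [Submodule.mem_bot]
    -- Functionals separate vectors at the sink, and each one extends over the course by pulling
    -- back along paths to the sink.
    refine (Module.forall_dual_apply_eq_zero_iff k y).1 fun ψ => ?_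
    have h1 := h (cosectionHom (S := Set.univ) (fun v => ψ ∘ₗ pathMap M (τ v))
      (fun v hv => absurd (Set.mem_univ v) hv) (fun {v v'} e _ => by
        refine LinearMap.ext fun z => ?_
        rw [pathMap_tour]
        exact congrArg ψ (hcomp (c.path e).some (τ v') (τ v) z)))
    rw [intervalCoord_compAt_cosectionHom _ _ _ (Set.mem_univ b)] at h1
    refine Eq.trans (congrArg ψ ?_) h1
    exact ((LinearMap.congr_fun (hM (τ b) Quiver.Path.nil) _).trans
      (LinearMap.congr_fun (pathMap_nil M _) _)).symm

end

/-! ### Multiplicities over the quiver of type `A_n` -/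

section

variable {k : Type u} [Field k] {n : ℕ}

theorem EquiA.nonempty_path_iff {i j : EquiA n} :
    Nonempty (Quiver.Path i j) ↔ i.idx ≤ j.idx := by
  refine ⟨fun ⟨p⟩ => EquiA.path_le p, fun h => ?_⟩
  obtain ⟨⟨j, hj⟩⟩ := j
  induction j with
  | zero =>
    obtain ⟨⟨i, hi⟩⟩ := i
    obtain rfl : i = 0 := by simpa using h
    exact ⟨.nil⟩
  | succ j ih =>
    obtain ⟨⟨i, hi⟩⟩ := i
    rcases Nat.lt_or_ge i (j + 1) with h1 | h1
    · obtain ⟨p⟩ := ih (by omega) (by simp; omega)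
      exact ⟨p.cons ⟨rfl⟩⟩
    · obtain rfl : i = j + 1 := le_antisymm (by simpa using h) h1
      exact ⟨.nil⟩

/-- The vertices between `s` and `t`. -/
def EquiA.between (s t : EquiA n) : Set (EquiA n) := {v | s.idx ≤ v.idx ∧ v.idx ≤ t.idx}

theorem EquiA.ext_idx {i j : EquiA n} (h : i.idx.val = j.idx.val) : i = j := by
  obtain ⟨i⟩ := i
  obtain ⟨j⟩ := j
  exact congrArg EquiA.mk (Fin.ext h)

theorem EquiA.between_convex (s t : EquiA n) : ∀ u ∈ between s t, ∀ v ∈ between s t, ∀ x : EquiA n,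
    Nonempty (Quiver.Path u x) → Nonempty (Quiver.Path x v) → x ∈ between s t :=
  fun _ hu _ hv _ hp hq =>
    ⟨hu.1.trans (nonempty_path_iff.1 hp), (nonempty_path_iff.1 hq).trans hv.2⟩

theorem EquiA.walkConnectedOn_between (s t : EquiA n) : WalkConnectedOn (between s t) := by
  suffices h : ∀ (m : ℕ) (a b : between s t), a.1.idx.val + m = b.1.idx.val →
      Relation.ReflTransGen
        (fun x y : between s t => Nonempty (x.1 ⟶ y.1) ∨ Nonempty (y.1 ⟶ x.1)) a b by
    intro a b
    rcases le_total a.1.idx.val b.1.idx.val with hab | hab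
    · exact h _ a b (Nat.add_sub_cancel' hab)
    · have := h _ b a (Nat.add_sub_cancel' hab)
      have hsymm : Std.Symm fun x y : between s t => Nonempty (x.1 ⟶ y.1) ∨ Nonempty (y.1 ⟶ x.1) :=
        ⟨fun _ _ => Or.symm⟩
      exact Std.Symm.symm _ _ this
  intro m
  induction m with
  | zero =>
    intro a b hab
    obtain rfl : a = b := Subtype.ext (ext_idx hab)
    exact .refl
  | succ m ih =>
    intro a b hab
    have h1 : a.1.idx.val + m < n := by have := b.1.idx.2; omega
    have h2 := a.2.1
    have h3 := b.2.2
    rw [Fin.le_def] at h2 h3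
    let c : between s t := ⟨⟨⟨a.1.idx.val + m, h1⟩⟩,
      Fin.le_def.2 (by simp only; omega), Fin.le_def.2 (by simp only; omega)⟩
    exact (ih a c rfl).tail (.inl ⟨⟨hab⟩⟩)

/-- The multiplicity of an interval representation of `A_n` in terms of ranks; `h` stands for the
map along the arrow that leaves the interval, and `g'` for the map along the path through the arrow
that enters it. -/
theorem indecMultiplicity_between {N : QRep k (EquiA n)} {s t : EquiA n} (p : Quiver.Path s t)
    {U U' : Type*} [AddCommGroup U] [Module k U] [AddCommGroup U'] [Module k U']
    (h : N.space t →ₗ[k] U) (g' : U' →ₗ[k] N.space t)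
    (hh : ∀ y, h y = 0 ↔ ∀ c (e : t ⟶ c), pathMap N e.toPath y = 0)
    (hg' : ∀ y, y ∈ LinearMap.range g' ↔
      y = 0 ∨ ∃ (a : EquiA n) (e : a ⟶ s) (x : N.space a),
        pathMap N p (pathMap N e.toPath x) = y) :
    indecMultiplicity k N (intervalRep k (EquiA.between s t)) +
        Module.finrank k (LinearMap.range (h ∘ₗ pathMap N p)) +
        Module.finrank k (LinearMap.range g') =
      Module.finrank k (LinearMap.range (pathMap N p)) +
        Module.finrank k (LinearMap.range (h ∘ₗ g')) := by
  classical
  have hst : s.idx ≤ t.idx := EquiA.path_le p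
  have hsS : s ∈ EquiA.between s t := ⟨le_rfl, hst⟩
  have htS : t ∈ EquiA.between s t := ⟨hst, le_rfl⟩
  have hcomp : ∀ {x y z : EquiA n} (p : Quiver.Path x y) (q : Quiver.Path y z)
      (r : Quiver.Path x z) (u : N.space x), pathMap N q (pathMap N p u) = pathMap N r u :=
    fun p q r u => by
      rw [EquiA.path_unique r (p.comp q), pathMap_comp, LinearMap.comp_apply]
  have hleave : ∀ {a b : EquiA n}, (a ⟶ b) → a ∈ EquiA.between s t → b ∉ EquiA.between s t →
      a = t := by
    intro a b e ha hb
    have h1 := e.down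
    have h2 := ha.1
    have h3 := ha.2
    rw [EquiA.between, Set.mem_ofPred_eq, Fin.le_def, Fin.le_def] at hb
    rw [Fin.le_def] at h2 h3
    exact EquiA.ext_idx (by omega)
  have henter : ∀ {a b : EquiA n}, (a ⟶ b) → a ∉ EquiA.between s t → b ∈ EquiA.between s t →
      b = s := by
    intro a b e ha hb
    have h1 := e.down
    have h2 := hb.1
    have h3 := hb.2
    rw [EquiA.between, Set.mem_ofPred_eq, Fin.le_def, Fin.le_def] at ha
    rw [Fin.le_def] at h2 h3
    exact EquiA.ext_idx (by omega)
  -- Whatever comes from before `s` passes through `s` on its way to `t`.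
  have hle : LinearMap.range g' ≤ LinearMap.range (pathMap N p) := by
    intro y hy
    rcases (hg' y).1 hy with rfl | ⟨a, e, x, rfl⟩
    · exact Submodule.zero_mem _
    · exact ⟨_, rfl⟩
  have hsec : ∀ x : intervalRep k (EquiA.between s t) ⟶ N,
      pathMap N p (compAt x s (intervalUnit k _ s)) = compAt x t (intervalUnit k _ t) := by
    intro x
    rw [← compAt_pathMap, pathMap_intervalRep_of_convex (EquiA.between_convex s t) p hsS htS,
      intervalCoord_unit hsS, one_smul]
  have key := indecMultiplicity_intervalRep (k := k) (N := N)
    (EquiA.walkConnectedOn_between s t) htS (pathMap N p) hsec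
    (LinearMap.ker (h ∘ₗ pathMap N p)) ?_ (LinearMap.range g') ?_
  -- The multiplicity is the dimension of `ker h` within the image of `p`, minus that of `ker h`
  -- within the image of `g'`. Rank-nullity for `h` on both images turns this into the four ranks.
  · have e1 : (LinearMap.ker (h ∘ₗ pathMap N p)).map (pathMap N p) =
        LinearMap.range (pathMap N p) ⊓ LinearMap.ker h := by
      rw [LinearMap.ker_comp, Submodule.map_comap_eq]
    have e2 : LinearMap.range (pathMap N p) ⊓ LinearMap.ker h ⊓ LinearMap.range g' =
        LinearMap.range g' ⊓ LinearMap.ker h := by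
      rw [inf_right_comm, inf_eq_right.2 hle]
    have e3 := finrank_map_add_finrank_inf_ker h (LinearMap.range (pathMap N p))
    have e4 := finrank_map_add_finrank_inf_ker h (LinearMap.range g')
    rw [← LinearMap.range_comp] at e3 e4
    rw [e1, e2] at key
    omega
  · intro y
    rw [LinearMap.mem_ker, LinearMap.comp_apply, hh]
    constructor
    · intro hy
      -- Extending `y` along the interval and by zero beyond is compatible: the only way out is an
      -- arrow from `t`, and `hy` says that the image of `y` dies there.
      let x : ∀ v, N.space v := fun v => if hv : v ∈ EquiA.between s t then
        pathMap N (EquiA.nonempty_path_iff.2 hv.1).some y else 0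
      have hx : ∀ {v} (_ : v ∈ EquiA.between s t) (q : Quiver.Path s v), x v = pathMap N q y := by
        intro v hv q
        simp only [x, hv, dite_true]
        rw [EquiA.path_unique q]
      have hx0 : ∀ v ∉ EquiA.between s t, x v = 0 := fun v hv => dif_neg hv
      refine ⟨sectionHom x hx0 fun {a b} e ha => ?_, ?_⟩
      · obtain ⟨q⟩ := EquiA.nonempty_path_iff.2 ha.1
        by_cases hb : b ∈ EquiA.between s t
        · rw [hx ha q, hx hb (q.cons e)]
          exact hcomp q e.toPath _ y
        · obtain rfl := hleave e ha hb
          rw [hx ha p, hx0 b hb, hy]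
      · rw [compAt_sectionHom_unit _ _ _ hsS, hx hsS Quiver.Path.nil, pathMap_nil,
          LinearMap.id_apply]
    · rintro ⟨x, rfl⟩ c e
      rw [hsec, pathMap_compAt_unit x e htS, compAt_unit_of_notMem]
      intro hc
      have h1 := e.down
      have h2 := hc.2
      rw [Fin.le_def] at h2
      omega
  · intro y
    constructor
    · intro hy φ
      rcases (hg' y).1 hy with rfl | ⟨a, e, x, rfl⟩
      · rw [map_zero, map_zero]
      · have ha : a ∉ EquiA.between s t := by
          intro ha
          have h1 := e.down
          have h2 := ha.1
          rw [Fin.le_def] at h2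
          omega
        rw [compAt_pathMap, pathMap_intervalRep_of_convex (EquiA.between_convex s t) p hsS htS,
          intervalCoord_compAt_pathMap φ e hsS, intervalCoord_of_notMem ha, LinearMap.zero_apply,
          zero_smul, map_zero]
    · intro hy
      by_contra hcon
      -- Outside the range of `g'`, `y` is detected by a functional vanishing on that range. The
      -- vanishing is what lets its pullbacks be continued by zero before `s`.
      obtain ⟨ψ, hψ, hψ'⟩ := Submodule.exists_le_ker_of_notMem hcon
      refine hψ ?_
      let l : ∀ v, N.space v →ₗ[k] k := fun v => if hv : v ∈ EquiA.between s t then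
        ψ ∘ₗ pathMap N (EquiA.nonempty_path_iff.2 hv.2).some else 0
      have hl : ∀ {v} (_ : v ∈ EquiA.between s t) (q : Quiver.Path v t),
          l v = ψ ∘ₗ pathMap N q := by
        intro v hv q
        simp only [l, hv, dite_true]
        rw [EquiA.path_unique q]
      have hl0 : ∀ v ∉ EquiA.between s t, l v = 0 := fun v hv => dif_neg hv
      have h1 := hy (cosectionHom l hl0 fun {a b} e hb => by
        refine LinearMap.ext fun z => ?_
        obtain ⟨q⟩ := EquiA.nonempty_path_iff.2 hb.2
        by_cases ha : a ∈ EquiA.between s t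
        · rw [hl ha (e.toPath.comp q), hl hb q]
          exact congrArg ψ (hcomp e.toPath q _ z)
        · obtain rfl := henter e ha hb
          rw [hl0 a ha, hl hb p]
          exact hψ' ((hg' _).2 (.inr ⟨a, e, z, rfl⟩)))
      rwa [intervalCoord_compAt_cosectionHom _ _ _ htS, hl htS Quiver.Path.nil, pathMap_nil] at h1

end

/-! ### Intervals in the rows of the ladder -/

section

theorem ProdQuiver.nonempty_path_fst {U V : Type*} [Quiver U] [Quiver V] {x y : ProdQuiver U V}
    (p : Quiver.Path x y) : Nonempty (Quiver.Path x.fst y.fst) := by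
  induction p with
  | nil => exact ⟨.nil⟩
  | cons _ e ih =>
    change ProdQuiver.Arrow _ _ at e
    cases e with
    | horiz α _ => exact ih.map fun q => q.cons α
    | vert => exact ih

theorem ProdQuiver.nonempty_path_snd {U V : Type*} [Quiver U] [Quiver V] {x y : ProdQuiver U V}
    (p : Quiver.Path x y) : Nonempty (Quiver.Path x.snd y.snd) := by
  induction p with
  | nil => exact ⟨.nil⟩
  | cons _ e ih =>
    change ProdQuiver.Arrow _ _ at e
    cases e with
    | horiz => exact ih
    | vert _ α' => exact ih.map fun q => q.cons α'

variable {n : ℕ}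

theorem EquiA.hom_unique {i j : EquiA n} (e e' : i ⟶ j) : e = e' :=
  Subsingleton.elim (α := PLift (i.idx.val + 1 = j.idx.val)) e e'

/-- The vertices of `T`, placed in row `r`. -/
def rowCopy (r : Fin 2) (T : Set (EquiA n)) : Set (Ladder n) := {v | v.snd = ⟨r⟩ ∧ v.fst ∈ T}

theorem mk_mem_rowCopy {r : Fin 2} {T : Set (EquiA n)} {i : EquiA n} :
    (⟨i, ⟨r⟩⟩ : Ladder n) ∈ rowCopy r T ↔ i ∈ T := ⟨fun h => h.2, fun h => ⟨rfl, h⟩⟩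

theorem rowPart_rowCopy (r : Fin 2) (T : Set (EquiA n)) : rowPart (rowCopy r T) r = T :=
  Set.ext fun _ => mk_mem_rowCopy

theorem rowPart_convex (J : QInterval (Ladder n)) (r : Fin 2) {i j l : EquiA n}
    (hi : i ∈ rowPart J.1 r) (hl : l ∈ rowPart J.1 r) (hij : i.idx ≤ j.idx) (hjl : j.idx ≤ l.idx) :
    j ∈ rowPart J.1 r :=
  J.2.2 _ hi _ hl _
    ((EquiA.nonempty_path_iff.2 hij).map (ProdQuiver.row (⟨r⟩ : EquiA 2)).mapPath)
    ((EquiA.nonempty_path_iff.2 hjl).map (ProdQuiver.row (⟨r⟩ : EquiA 2)).mapPath)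

theorem isInterval_rowCopy_between (r : Fin 2) {s t : EquiA n} (h : s.idx ≤ t.idx) :
    IsInterval (rowCopy r (EquiA.between s t)) := by
  refine ⟨⟨⟨⟨⟨s, ⟨r⟩⟩, rfl, le_rfl, h⟩⟩, ?_⟩, ?_⟩
  · rintro ⟨⟨a, a'⟩, ha⟩ ⟨⟨b, b'⟩, hb⟩
    obtain rfl : a' = ⟨r⟩ := ha.1
    obtain rfl : b' = ⟨r⟩ := hb.1
    refine (EquiA.walkConnectedOn_between s t ⟨a, ha.2⟩ ⟨b, hb.2⟩).lift
      (fun v => (⟨⟨v.1, ⟨r⟩⟩, rfl, v.2⟩ : rowCopy r (EquiA.between s t))) fun x y hxy => ?_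
    exact hxy.imp (fun ⟨e⟩ => ⟨ProdQuiver.Arrow.horiz e _⟩)
      (fun ⟨e⟩ => ⟨ProdQuiver.Arrow.horiz e _⟩)
  · rintro ⟨a, _⟩ ⟨rfl, ha⟩ ⟨b, _⟩ ⟨rfl, hb⟩ ⟨x, y⟩ ⟨p⟩ ⟨q⟩
    refine ⟨?_, EquiA.between_convex s t a ha b hb x (ProdQuiver.nonempty_path_fst p)
      (ProdQuiver.nonempty_path_fst q)⟩
    have h1 := EquiA.nonempty_path_iff.1 (ProdQuiver.nonempty_path_snd p)
    have h2 := EquiA.nonempty_path_iff.1 (ProdQuiver.nonempty_path_snd q)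
    exact EquiA.ext_idx (congrArg Fin.val (le_antisymm h2 h1))

theorem source_mem_essentialVertices (r : Fin 2) {s t : EquiA n} (h : s.idx ≤ t.idx) :
    (⟨s, ⟨r⟩⟩ : Ladder n) ∈ essentialVertices (rowCopy r (EquiA.between s t)) := by
  refine ⟨⟨rfl, le_rfl, h⟩, .inl ?_⟩
  rintro ⟨a, b⟩ ⟨hb, ha⟩
  refine ⟨fun e => ?_⟩
  change ProdQuiver.Arrow _ _ at e
  cases e with
  | horiz α _ =>
    have h1 := α.down
    have h2 := Fin.le_def.1 ha.1
    dsimp only at h2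
    omega
  | vert _ α' =>
    have h1 := α'.down
    dsimp only at hb
    subst hb
    omega

theorem sink_mem_essentialVertices (r : Fin 2) {s t : EquiA n} (h : s.idx ≤ t.idx) :
    (⟨t, ⟨r⟩⟩ : Ladder n) ∈ essentialVertices (rowCopy r (EquiA.between s t)) := by
  refine ⟨⟨rfl, h, le_rfl⟩, .inr ?_⟩
  rintro ⟨a, b⟩ ⟨hb, ha⟩
  refine ⟨fun e => ?_⟩
  change ProdQuiver.Arrow _ _ at e
  cases e with
  | horiz α _ =>
    have h1 := α.down
    have h2 := Fin.le_def.1 ha.2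
    dsimp only at h2
    omega
  | vert _ α' =>
    have h1 := α'.down
    dsimp only at hb
    subst hb
    omega

theorem SupportedInRow.nonempty_rowPart {I : QInterval (Ladder n)} {r : Fin 2}
    (h : SupportedInRow I r) : (rowPart I.1 r).Nonempty := by
  obtain ⟨⟨⟨a, b⟩, hv⟩⟩ := I.2.1.1
  obtain rfl : b = ⟨r⟩ := h _ hv
  exact ⟨a, hv⟩

/-- The row part is finite and convex, so it runs from its least to its greatest vertex. -/
theorem exists_rowPart_eq_between {I : QInterval (Ladder n)} {r : Fin 2}
    (h : (rowPart I.1 r).Nonempty) :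
    ∃ s t : EquiA n, s.idx ≤ t.idx ∧ rowPart I.1 r = EquiA.between s t := by
  obtain ⟨s, hs, hs'⟩ := Set.exists_min_image _ EquiA.idx (Set.toFinite (rowPart I.1 r)) h
  obtain ⟨t, ht, ht'⟩ := Set.exists_max_image _ EquiA.idx (Set.toFinite (rowPart I.1 r)) h
  exact ⟨s, t, hs' t ht, Set.ext fun v =>
    ⟨fun hv => ⟨hs' v hv, ht' v hv⟩, fun hv => rowPart_convex I r hs ht hv.1 hv.2⟩⟩

theorem bridgesRows_iff {J : QInterval (Ladder n)} :
    BridgesRows J ↔ ∀ r, (rowPart J.1 r).Nonempty := by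
  rw [Fin.forall_fin_two, BridgesRows]

theorem SupportedInRow.eq_of_mem {I : QInterval (Ladder n)} {r r' : Fin 2}
    (h : SupportedInRow I r) (h' : (rowPart I.1 r').Nonempty) : r' = r := by
  obtain ⟨i, hi⟩ := h'
  exact congrArg EquiA.idx (h _ hi)

/-- An interval missing the other row is determined by its part in row `r`. This is why the
auxiliary function corrects a row interval only by bridging ones. -/
theorem SupportedInRow.eq_or_bridgesRows {I J : QInterval (Ladder n)} {r : Fin 2}
    (hI : SupportedInRow I r) (h : rowPart J.1 r = rowPart I.1 r) : J = I ∨ BridgesRows J := by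
  rw [or_iff_not_imp_right, bridgesRows_iff]
  intro hJ
  push Not at hJ
  obtain ⟨r', hr'⟩ := hJ
  have hJr : (rowPart J.1 r).Nonempty := h ▸ hI.nonempty_rowPart
  have hne : r ≠ r' := by
    rintro rfl
    exact hJr.ne_empty hr'
  refine Subtype.ext (Set.ext ?_)
  rintro ⟨i, ⟨q⟩⟩
  by_cases hq : q = r
  · subst hq
    exact Set.ext_iff.1 h i
  · obtain rfl : q = r' := by omega
    exact ⟨fun hi => absurd (show i ∈ rowPart J.1 q from hi) (by simp [hr']),
      fun hi => absurd (hI.eq_of_mem ⟨i, hi⟩) hq⟩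

theorem SupportedInRow.not_bridgesRows {I : QInterval (Ladder n)} {r : Fin 2}
    (hI : SupportedInRow I r) : ¬ BridgesRows I := fun h => by
  rw [bridgesRows_iff] at h
  have h0 := hI.eq_of_mem (h 0)
  have h1 := hI.eq_of_mem (h 1)
  omega

end

/-! ### The auxiliary function and the rows -/

section

variable {k : Type u} [Field k] {n : ℕ}

theorem finrank_range_pathMap_rowRep (M : QRep k (Ladder n)) (r : Fin 2) {i j : EquiA n}
    (p : Quiver.Path i j) :
    Module.finrank k (LinearMap.range (pathMap (rowRep M r) p)) =
      Module.finrank k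
        (LinearMap.range (pathMap M ((ProdQuiver.row (⟨r⟩ : EquiA 2)).mapPath p))) := by
  suffices h : ∀ x : M.space ⟨i, ⟨r⟩⟩, pathMap (rowRep M r) p x =
      pathMap M ((ProdQuiver.row (⟨r⟩ : EquiA 2)).mapPath p) x from
    congrArg (fun f : M.space ⟨i, ⟨r⟩⟩ →ₗ[k] M.space ⟨j, ⟨r⟩⟩ =>
      Module.finrank k (LinearMap.range f)) (LinearMap.ext h)
  intro x
  induction p with
  | nil =>
    exact (LinearMap.congr_fun (pathMap_nil (rowRep M r) i) x).trans
      (LinearMap.congr_fun (pathMap_nil M ⟨i, ⟨r⟩⟩) x).symm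
  | @cons m j p e ih =>
    have h1 := LinearMap.congr_fun (pathMap_comp (rowRep M r) p e.toPath) x
    have h2 := LinearMap.congr_fun (pathMap_comp M ((ProdQuiver.row (⟨r⟩ : EquiA 2)).mapPath p)
      ((ProdQuiver.row (⟨r⟩ : EquiA 2)).map e).toPath) x
    have h3 : pathMap (rowRep M r) e.toPath =
        pathMap M ((ProdQuiver.row (⟨r⟩ : EquiA 2)).map e).toPath :=
      congrArg (fun f : (rowRep M r).obj ((Paths.of (EquiA n)).obj m) ⟶
        (rowRep M r).obj ((Paths.of (EquiA n)).obj j) => f.hom.hom) (Paths.lift_toPath _ e)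
    refine h1.trans (Eq.trans ?_ h2.symm)
    exact (LinearMap.congr_fun h3 _).trans
      (congrArg (pathMap M ((ProdQuiver.row (⟨r⟩ : EquiA 2)).map e).toPath) ih)

-- An interval contains the segment from `s` to `t` in row `r` as soon as it contains both ends, by
-- convexity. The left side is therefore the defining sum for the compressed multiplicity of that
-- segment, which has a single source and a single sink.
open Classical in
theorem sum_intervalApproximation_eq_finrank (ξ : EssentialAssignment.{w, w'} (Ladder n))
    (M : QRep k (Ladder n)) (hM : SatisfiesRelations (ladderRel n) M) (r : Fin 2) {s t : EquiA n}
    (p : Quiver.Path s t) :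
    ∑ J : QInterval (Ladder n) with s ∈ rowPart J.1 r ∧ t ∈ rowPart J.1 r,
        intervalApproximation ξ M J =
      Module.finrank k (LinearMap.range (pathMap (rowRep M r) p)) := by
  have hst := EquiA.path_le p
  let I : QInterval (Ladder n) := ⟨_, isInterval_rowCopy_between r hst⟩
  have h1 := upperInversion_spec (fun I => (compressedMultiplicity ξ M I : ℤ)) I
  have h2 : compressedMultiplicity ξ M I = _ := compressedMultiplicity_eq_finrank ξ
    (fun p q => congrArg (fun f => f.hom.hom) (ladder_fullyCommutative hM p q)) I
    (source_mem_essentialVertices r hst) (sink_mem_essentialVertices r hst)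
    (by
      rintro ⟨v, _⟩ ⟨rfl, hv⟩
      exact (EquiA.nonempty_path_iff.2 hv.1).map (ProdQuiver.row (⟨r⟩ : EquiA 2)).mapPath)
    (by
      rintro ⟨v, _⟩ ⟨rfl, hv⟩
      exact (EquiA.nonempty_path_iff.2 hv.2).map (ProdQuiver.row (⟨r⟩ : EquiA 2)).mapPath)
    ((ProdQuiver.row (⟨r⟩ : EquiA 2)).mapPath p)
  rw [finrank_range_pathMap_rowRep, ← h2, h1]
  refine Finset.sum_congr (Finset.filter_congr fun J _ => ?_) fun _ _ => rfl
  constructor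
  · rintro ⟨hs, ht⟩ ⟨v, _⟩ ⟨rfl, hv⟩
    exact rowPart_convex J r hs ht hv.1 hv.2
  · intro h
    exact ⟨h (mk_mem_rowCopy.2 ⟨le_rfl, hst⟩), h (mk_mem_rowCopy.2 ⟨hst, le_rfl⟩)⟩

open Classical in
theorem auxiliaryFunction_eq_sum (ξ : EssentialAssignment.{w, w'} (Ladder n))
    (M : QRep k (Ladder n)) (r : Fin 2) {I : QInterval (Ladder n)} (hI : SupportedInRow I r) :
    auxiliaryFunction ξ M I =
      ∑ J : QInterval (Ladder n) with rowPart J.1 r = rowPart I.1 r,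
        intervalApproximation ξ M J := by
  have h1 : auxiliaryFunction ξ M I = intervalApproximation ξ M I +
      ∑ J : QInterval (Ladder n) with BridgesRows J ∧ rowPart J.1 r = rowPart I.1 r,
        intervalApproximation ξ M J := by
    unfold auxiliaryFunction
    obtain rfl | rfl : r = 0 ∨ r = 1 := by omega
    · rw [if_pos hI]
    · rw [if_neg fun h0 => absurd (h0.eq_of_mem hI.nonempty_rowPart) (by decide), if_pos hI]
  rw [h1, ← Finset.sum_insert (by simp [hI.not_bridgesRows])]
  refine Finset.sum_congr (Finset.ext fun J => ?_) fun _ _ => rfl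
  simp only [Finset.mem_insert, Finset.mem_filter, Finset.mem_univ, true_and]
  constructor
  · rintro (rfl | h)
    exacts [rfl, h.2]
  · exact fun h => (hI.eq_or_bridgesRows h).imp_right fun hb => ⟨hb, h⟩

/-- Inclusion-exclusion for excluding `A` and `B` within `P`, with the negative terms moved across.
It is used with `P`: both ends lie in the row part; `A`, `B`: the row part goes on before `s`, after
`t`. -/
theorem sum_filter_and_not_and_not {ι : Type*} (X : Finset ι) (f : ι → ℤ) (P A B : ι → Prop)
    [DecidablePred P] [DecidablePred A] [DecidablePred B] :
    ∑ j ∈ X with P j ∧ ¬ A j ∧ ¬ B j, f j + ∑ j ∈ X with P j ∧ B j, f j +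
        ∑ j ∈ X with A j ∧ P j, f j =
      ∑ j ∈ X with P j, f j + ∑ j ∈ X with A j ∧ P j ∧ B j, f j := by
  simp only [Finset.sum_filter, ← Finset.sum_add_distrib]
  refine Finset.sum_congr rfl fun j _ => ?_
  by_cases hP : P j <;> by_cases hA : A j <;> by_cases hB : B j <;> simp [hP, hA, hB]

-- Treats uniformly whether `s` has a predecessor: `g'` is the map from the predecessor to `t`, or
-- zero if there is none, in which case the sums are empty too.
open Classical in
theorem exists_entering_map (ξ : EssentialAssignment.{w, w'} (Ladder n))
    (M : QRep k (Ladder n)) (hM : SatisfiesRelations (ladderRel n) M) (r : Fin 2) {s t : EquiA n}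
    (p : Quiver.Path s t) :
    ∃ (a : EquiA n) (g' : (rowRep M r).space a →ₗ[k] (rowRep M r).space t),
      (∀ y, y ∈ LinearMap.range g' ↔
        y = 0 ∨ ∃ (a : EquiA n) (e : a ⟶ s) (x : (rowRep M r).space a),
          pathMap (rowRep M r) p (pathMap (rowRep M r) e.toPath x) = y) ∧
      ∀ (c : EquiA n) (q : Quiver.Path t c),
        ∑ J : QInterval (Ladder n) with (∃ a, Nonempty (a ⟶ s) ∧ a ∈ rowPart J.1 r) ∧
            s ∈ rowPart J.1 r ∧ c ∈ rowPart J.1 r, intervalApproximation ξ M J =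
          Module.finrank k (LinearMap.range (pathMap (rowRep M r) q ∘ₗ g')) := by
  have huniq : ∀ {a b : EquiA n}, (a ⟶ s) → (b ⟶ s) → a = b := fun e e' =>
    EquiA.ext_idx (Nat.succ_injective (e.down.trans e'.down.symm))
  by_cases h : ∃ a : EquiA n, Nonempty (a ⟶ s)
  · obtain ⟨a, ⟨e⟩⟩ := h
    refine ⟨a, pathMap _ (e.toPath.comp p), fun y => ?_, fun c q => ?_⟩
    · rw [pathMap_comp]
      constructor
      · rintro ⟨x, rfl⟩
        exact .inr ⟨a, e, x, rfl⟩
      · rintro (rfl | ⟨b, e', x, rfl⟩)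
        · exact Submodule.zero_mem _
        · obtain rfl := huniq e e'
          rw [EquiA.hom_unique e' e]
          exact ⟨x, rfl⟩
    · rw [← pathMap_comp, ← sum_intervalApproximation_eq_finrank ξ M hM]
      refine Finset.sum_congr (Finset.filter_congr fun J _ => ?_) fun _ _ => rfl
      constructor
      · rintro ⟨⟨b, ⟨e'⟩, hb⟩, _, hc⟩
        obtain rfl := huniq e e'
        exact ⟨hb, hc⟩
      · rintro ⟨ha, hc⟩
        exact ⟨⟨a, ⟨e⟩, ha⟩, rowPart_convex J r ha hc (EquiA.path_le e.toPath)
          (EquiA.path_le (p.comp q)), hc⟩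
  · push Not at h
    refine ⟨t, 0, fun y => ?_, fun c q => ?_⟩
    · rw [LinearMap.range_zero, Submodule.mem_bot]
      exact ⟨.inl, fun hy => hy.resolve_right fun ⟨b, e, _⟩ => (h b).elim e⟩
    · rw [LinearMap.comp_zero, LinearMap.range_zero, finrank_bot, Nat.cast_zero]
      refine Finset.sum_eq_zero fun J hJ => ?_
      obtain ⟨⟨b, ⟨e⟩, _⟩, _⟩ := (Finset.mem_filter.1 hJ).2
      exact (h b).elim e

-- A convex row part containing `s` and `t` equals the segment between them exactly when it contains
-- neither the predecessor of `s` nor the successor of `t`. Inclusion-exclusion then matches the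
-- rank formula for the multiplicity term by term.
open Classical in
theorem sum_intervalApproximation_eq_indecMultiplicity
    (ξ : EssentialAssignment.{w, w'} (Ladder n)) (M : QRep k (Ladder n))
    (hM : SatisfiesRelations (ladderRel n) M) (r : Fin 2) {s t : EquiA n} (hst : s.idx ≤ t.idx) :
    ∑ J : QInterval (Ladder n) with rowPart J.1 r = EquiA.between s t,
        intervalApproximation ξ M J =
      indecMultiplicity k (rowRep M r) (intervalRep k (EquiA.between s t)) := by
  obtain ⟨p⟩ := EquiA.nonempty_path_iff.2 hst
  obtain ⟨a, g', hg', hsum⟩ := exists_entering_map ξ M hM r p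
  have hfilter : ∀ J : QInterval (Ladder n), rowPart J.1 r = EquiA.between s t ↔
      (s ∈ rowPart J.1 r ∧ t ∈ rowPart J.1 r) ∧
        ¬ (∃ a, Nonempty (a ⟶ s) ∧ a ∈ rowPart J.1 r) ∧
        ¬ (∃ c, Nonempty (t ⟶ c) ∧ c ∈ rowPart J.1 r) := by
    intro J
    constructor
    · intro h
      rw [h]
      refine ⟨⟨⟨le_rfl, hst⟩, ⟨hst, le_rfl⟩⟩, ?_, ?_⟩
      · rintro ⟨a, ⟨e⟩, ha⟩
        have h1 := e.down
        have h2 := Fin.le_def.1 ha.1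
        omega
      · rintro ⟨c, ⟨e⟩, hc⟩
        have h1 := e.down
        have h2 := Fin.le_def.1 hc.2
        omega
    · rintro ⟨⟨hs, ht⟩, hA, hB⟩
      refine Set.ext fun v => ⟨fun hv => ⟨?_, ?_⟩, fun hv => rowPart_convex J r hs ht hv.1 hv.2⟩
      · by_contra hlt
        rw [Fin.le_def, not_le] at hlt
        have hs2 := s.idx.2
        refine hA ⟨⟨⟨s.idx.val - 1, by omega⟩⟩, ⟨⟨by simp only; omega⟩⟩,
          rowPart_convex J r hv hs ?_ ?_⟩
        · rw [Fin.le_def]; simp only; omega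
        · rw [Fin.le_def]; simp only; omega
      · by_contra hlt
        rw [Fin.le_def, not_le] at hlt
        have hv2 := v.idx.2
        refine hB ⟨⟨⟨t.idx.val + 1, by omega⟩⟩, ⟨⟨rfl⟩⟩, rowPart_convex J r ht hv ?_ ?_⟩
        · rw [Fin.le_def]; simp only; omega
        · rw [Fin.le_def]; simp only; omega
  have key := sum_filter_and_not_and_not (Finset.univ : Finset (QInterval (Ladder n)))
    (intervalApproximation ξ M) (fun J => s ∈ rowPart J.1 r ∧ t ∈ rowPart J.1 r)
    (fun J => ∃ a, Nonempty (a ⟶ s) ∧ a ∈ rowPart J.1 r)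
    (fun J => ∃ c, Nonempty (t ⟶ c) ∧ c ∈ rowPart J.1 r)
  rw [Finset.sum_congr (Finset.filter_congr fun J _ => hfilter J) fun _ _ => rfl]
  -- The trivial path at `t` gives the rank of the entering map itself.
  have hA := hsum t .nil
  rw [pathMap_nil, LinearMap.id_comp] at hA
  rw [sum_intervalApproximation_eq_finrank ξ M hM r p, hA] at key
  suffices h : ∃ (c : EquiA n) (h : (rowRep M r).space t →ₗ[k] (rowRep M r).space c),
      (∀ y, h y = 0 ↔ ∀ c (e : t ⟶ c), pathMap (rowRep M r) e.toPath y = 0) ∧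
      ∑ J : QInterval (Ladder n) with (s ∈ rowPart J.1 r ∧ t ∈ rowPart J.1 r) ∧
          ∃ c, Nonempty (t ⟶ c) ∧ c ∈ rowPart J.1 r, intervalApproximation ξ M J =
        Module.finrank k (LinearMap.range (h ∘ₗ pathMap (rowRep M r) p)) ∧
      ∑ J : QInterval (Ladder n) with (∃ a, Nonempty (a ⟶ s) ∧ a ∈ rowPart J.1 r) ∧
          (s ∈ rowPart J.1 r ∧ t ∈ rowPart J.1 r) ∧
          ∃ c, Nonempty (t ⟶ c) ∧ c ∈ rowPart J.1 r, intervalApproximation ξ M J =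
        Module.finrank k (LinearMap.range (h ∘ₗ g')) by
    obtain ⟨c, h, hh, h1, h2⟩ := h
    have := indecMultiplicity_between p h g' hh hg'
    rw [h1, h2] at key
    zify at this
    linarith
  have huniq : ∀ {a b : EquiA n}, (t ⟶ a) → (t ⟶ b) → a = b := fun e e' =>
    EquiA.ext_idx (e.down.symm.trans e'.down)
  by_cases hc : ∃ c : EquiA n, Nonempty (t ⟶ c)
  · obtain ⟨c, ⟨e⟩⟩ := hc
    have hiff : ∀ J : QInterval (Ladder n), ((s ∈ rowPart J.1 r ∧ t ∈ rowPart J.1 r) ∧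
        ∃ c, Nonempty (t ⟶ c) ∧ c ∈ rowPart J.1 r) ↔
          s ∈ rowPart J.1 r ∧ c ∈ rowPart J.1 r := by
      intro J
      constructor
      · rintro ⟨⟨hs, _⟩, c', ⟨e'⟩, hc'⟩
        obtain rfl := huniq e e'
        exact ⟨hs, hc'⟩
      · rintro ⟨hs, hc⟩
        exact ⟨⟨hs, rowPart_convex J r hs hc hst (EquiA.path_le e.toPath)⟩, c, ⟨e⟩, hc⟩
    refine ⟨c, pathMap _ e.toPath, fun y => ⟨fun hy c' e' => ?_, fun hy => hy c e⟩, ?_, ?_⟩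
    · obtain rfl := huniq e e'
      rwa [EquiA.hom_unique e' e]
    · rw [← pathMap_comp, ← sum_intervalApproximation_eq_finrank ξ M hM]
      exact Finset.sum_congr (Finset.filter_congr fun J _ => hiff J) fun _ _ => rfl
    · rw [← hsum]
      exact Finset.sum_congr (Finset.filter_congr fun J _ => and_congr_right fun _ => hiff J)
        fun _ _ => rfl
  · push Not at hc
    -- When `t` is the last vertex, no condition is imposed on leaving the interval, so the zero map
    -- serves as `h`.
    refine ⟨t, 0, fun y => ⟨fun _ c e => (hc c).elim e, fun _ => rfl⟩, ?_, ?_⟩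
    · rw [LinearMap.zero_comp, LinearMap.range_zero, finrank_bot, Nat.cast_zero]
      refine Finset.sum_eq_zero fun J hJ => ?_
      obtain ⟨_, c, ⟨e⟩, _⟩ := (Finset.mem_filter.1 hJ).2
      exact (hc c).elim e
    · rw [LinearMap.zero_comp, LinearMap.range_zero, finrank_bot, Nat.cast_zero]
      refine Finset.sum_eq_zero fun J hJ => ?_
      obtain ⟨_, _, c, ⟨e⟩, _⟩ := (Finset.mem_filter.1 hJ).2
      exact (hc c).elim e

theorem indecMultiplicity_rowRep_eq_auxiliaryFunction
    (ξ : EssentialAssignment.{w, w'} (Ladder n)) (M : QRep k (Ladder n))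
    (hM : SatisfiesRelations (ladderRel n) M) {r : Fin 2} {I : QInterval (Ladder n)}
    (hI : SupportedInRow I r) :
    (indecMultiplicity k (rowRep M r) (intervalRep k (rowPart I.1 r)) : ℤ) =
      auxiliaryFunction ξ M I := by
  classical
  obtain ⟨s, t, hst, h⟩ := exists_rowPart_eq_between hI.nonempty_rowPart
  rw [auxiliaryFunction_eq_sum ξ M r hI, h,
    ← sum_intervalApproximation_eq_indecMultiplicity ξ M hM r hst]

theorem auxiliaryValue_rowSegment (ξ : EssentialAssignment.{w, w'} (Ladder n))
    (M : QRep k (Ladder n)) (hM : SatisfiesRelations (ladderRel n) M) (r : Fin 2) {b d : ℤ}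
    (hb : 1 ≤ b) (hbd : b ≤ d) (hd : d ≤ n) :
    auxiliaryValue ξ M (rowSegment n r b d) =
      indecMultiplicity k (rowRep M r) (intervalRep k (idxSegment n b d)) := by
  -- Segments are counted from 1, the vertices of `EquiA n` from 0.
  let s : EquiA n := ⟨⟨(b - 1).toNat, by omega⟩⟩
  let t : EquiA n := ⟨⟨(d - 1).toNat, by omega⟩⟩
  have hst : s.idx ≤ t.idx := Fin.le_def.2 (by simp only [s, t]; omega)
  have hT : idxSegment n b d = EquiA.between s t := by
    ext v
    simp only [idxSegment, EquiA.between, Set.mem_ofPred_eq, Fin.le_def, s, t]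
    omega
  have hS : rowSegment n r b d = rowCopy r (EquiA.between s t) := by rw [← hT]; rfl
  have hI := isInterval_rowCopy_between r hst
  have hsupp : SupportedInRow ⟨_, hI⟩ r := fun v hv => hv.1
  rw [hS, hT, auxiliaryValue, dif_pos hI,
    ← indecMultiplicity_rowRep_eq_auxiliaryFunction ξ M hM hsupp, rowPart_rowCopy]

end

end

/-! ### The two rows and their persistence diagrams -/

theorem mainTheorem5 {k : Type u} [Field k] (n : ℕ)
    (ξ : EssentialAssignment.{w, w'} (Ladder n))
    (M : QRep k (Ladder n)) (hM : SatisfiesRelations (ladderRel n) M) :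
    (∀ I : QInterval (Ladder n), SupportedInRow I 0 →
      (indecMultiplicity k (rowRep M 0) (intervalRep k (rowPart I.1 0)) : ℤ) =
        auxiliaryFunction ξ M I) ∧
    (∀ I : QInterval (Ladder n), SupportedInRow I 1 →
      (indecMultiplicity k (rowRep M 1) (intervalRep k (rowPart I.1 1)) : ℤ) =
        auxiliaryFunction ξ M I) ∧
    (∀ p : LowerTriangle,
      connectedPersistenceDiagram ξ M (.inl p) =
        (persistenceDiagram (rowRep M 0) (p.1.2, p.1.1) : ℤ)) ∧
    (∀ p : UpperTriangle,
      connectedPersistenceDiagram ξ M (.inr (.inl p)) =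
        (persistenceDiagram (rowRep M 1) p.1 : ℤ)) := by
  refine ⟨fun I hI => indecMultiplicity_rowRep_eq_auxiliaryFunction ξ M hM hI,
    fun I hI => indecMultiplicity_rowRep_eq_auxiliaryFunction ξ M hM hI, ?_, ?_⟩
  · rintro ⟨⟨d, b⟩, _, hb, hbd⟩
    dsimp only at hb hbd
    change (if d ≤ (n : ℤ) + 1 then auxiliaryValue ξ M (rowSegment n 0 b (d - 1)) else 0) = _
    rw [persistenceDiagram]
    by_cases hd : d ≤ n + 1
    · rw [if_pos hd, if_pos ⟨by simp only; omega, by simp only; omega, hd⟩]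
      exact auxiliaryValue_rowSegment ξ M hM 0 (by omega) (by omega) (by omega)
    · rw [if_neg hd, if_neg fun h => hd h.2.2, Nat.cast_zero]
  · rintro ⟨⟨b, d⟩, hb, _, hbd⟩
    dsimp only at hb hbd
    change (if d ≤ (n : ℤ) + 1 then auxiliaryValue ξ M (rowSegment n 1 b (d - 1)) else 0) = _
    rw [persistenceDiagram]
    by_cases hd : d ≤ n + 1
    · rw [if_pos hd, if_pos ⟨by simp only; omega, by simp only; omega, hd⟩]
      exact auxiliaryValue_rowSegment ξ M hM 1 (by omega) (by omega) (by omega)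
    · rw [if_neg hd, if_neg fun h => hd h.2.2, Nat.cast_zero]
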